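/- Let $d_1,d_2\ge 1$ be fixed. For each $n$ consider a model with $N=N_n\to\infty$ rows and $T=T_n\to\infty$ columns, $$Y=M+E,\quad M=M_1+M_2+M_3+M_4,\quad M_1=G_1(X)Q_1(Z)^\top,\ M_2=G_2(X)V_1^\top,\ M_3=W_1Q_2(Z)^\top,\ M_4=W_2V_2^\top,$$ with random covariates $X=(x_i)_{i\le N}$, $x_i\in\mathbb R^{d_1}$, and $Z=(z_t)_{t\le T}$, $z_t\in\mathbb R^{d_2}$; unknown functions $G_1(X)=(g_{1,k}(x_i))_{i\le N,k\le K_1}$, $G_2(X)=(g_{2,k}(x_i))_{i\le N,k\le K_2}$, $Q_1(Z)=(q_{1,k}(z_t))_{t\le T,k\le K_1}$, $Q_2(Z)=(q_{2,k}(z_t))_{t\le T,k\le K_3}$; and unobserved random matrices $W_1\in\mathbb R^{N\times K_3}$, $W_2\in\mathbb R^{N\times K_4}$, $V_1\in\mathbb R^{T\times K_2}$, $V_2\in\mathbb R^{T\times K_4}$. The numbers $K_1,\dots,K_4\ge 0$ and the sieve dimension $J\ge 1$ may depend on $n$. For basis functions $\phi_j,\psi_j:\mathbb R\to\mathbb R$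 $(j\le J)$ put $\boldsymbol\phi(x)=(\phi_j(x_l))_{l\le d_1,j\le J}$ and $\boldsymbol\psi(z)=(\psi_j(z_l))_{l\le d_2,j\le J}$, let $\Phi$ and $\Psi$ be the matrices with rows $\boldsymbol\phi(x_i)^\top$, $i\le N$, and $\boldsymbol\psi(z_t)^\top$, $t\le T$, and let $P_X=\Phi(\Phi^\top\Phi)^{-1}\Phi^\top$, $P_Z=\Psi(\Psi^\top\Psi)^{-1}\Psi^\top$. Let $\|\cdot\|_*$ be the nuclear norm. The estimator is $\widehat M=P_XYP_Z+\widehat M_2+\widehat M_3+\widehat M_4$, where $\widehat M_2,\widehat M_3,\widehat M_4$ minimize $\|B-A\|_F^2+\nu\|A\|_*$ over $A\in\mathbb R^{N\times T}$ with, respectively, $B=P_XY(I-P_Z)$, $\nu=c_2\sqrt T$; $B=(I-P_X)YP_Z$, $\nu=c_3\sqrt N$; and $B=(I-P_X)Y(I-P_Z)$, $\nu=c_4\sqrt{N+T}$. Assume the following. 1. (Noise) The entries $\epsilon_{it}$ of $E$ are independent with mean zero, $E$ is independent of $(X,Z)$, and there are constants $\sigma$ and $C_1,C_2>0$ with $\mathbb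 E[\epsilon_{it}^2]\le\sigma^2\le C_1$ and $\mathbb E[e^{s\epsilon_{it}}]\le e^{C_2s^2\sigma^2}$ for all $s\in\mathbb R$. 2. (Basis functions) For some constants $c,C>0$, with probability tending to one all singular values of $N^{-1}\Phi^\top\Phi$ and of $T^{-1}\Psi^\top\Psi$ lie strictly between $c$ and $C$; and $\mathbb E[\phi_j(x_{il})^4]<\infty$, $\mathbb E[\psi_j(z_{tl})^4]<\infty$ for all indices. 3. (Sieve approximation) There are constants $\gamma_1^G,\gamma_2^G,\gamma_1^Q,\gamma_2^Q\ge 2$ and vectors $b_{\iota,k}\in\mathbb R^{Jd_1}$, $a_{\iota,k}\in\mathbb R^{Jd_2}$ such that, uniformly in $k$, for $\iota=1,2$, $\sup_x|g_{\iota,k}(x)-b_{\iota,k}^\top\boldsymbol\phi(x)|=O(J^{-\gamma_\iota^G})$ over $x$ in the supports of the $x_i$, and $\sup_z|q_{\iota,k}(z)-a_{\iota,k}^\top\boldsymbol\psi(z)|=O(J^{-\gamma_\iota^Q})$ over $z$ in the supports of the $z_t$. Moreover $\sqrt T K_1/J^{\gamma_1^G}$, $\sqrt N K_1/J^{\gamma_1^Q}$,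 $\max\{\sqrt N,\sqrt T\}K_2/J^{\gamma_2^G}$ and $\max\{\sqrt N,\sqrt T\}K_3/J^{\gamma_2^Q}$ tend to $0$. 4. (Moments) $\mathbb E[m_{it}^4]$ is bounded uniformly in $n,i,t$, and the second moments of all $g_{\iota,k}(x_i)$, $q_{\iota,k}(z_t)$ and of all entries of $W_1,W_2,V_1,V_2$ are bounded by a constant. Let $$\begin{aligned}\mathcal R={}&J+\sqrt{K_2+K_4}\,\min\{\sqrt T,\|M_2\|_F+\|P_XM_4\|_F\}+\sqrt{K_3+K_4}\,\min\{\sqrt N,\|M_3\|_F+\|M_4P_Z\|_F\}\\&+\sqrt{K_4}\,\min\{\sqrt{N+T},\|M_4\|_F\}+\sqrt{NT}\Big(\frac{K_1}{J^{\gamma_1^G}}+\frac{K_1}{J^{\gamma_1^Q}}+\frac{K_2}{J^{\gamma_2^G}}+\frac{K_3}{J^{\gamma_2^Q}}\Big),\end{aligned}$$ let $K=\operatorname{rank}M$, let $\lambda_{\min}$ be the smallest nonzero singular value of $M$ (where $M=0$, read $\mathcal R/\lambda_{\min}$ as $0$), and assume $\mathcal R/\lambda_{\min}\to 0$ in probability.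 Let $U\in\mathbb R^{N\times K}$, $V\in\mathbb R^{T\times K}$ be left and right singular vectors of $M$ for its $K$ nonzero singular values, and $\widehat U,\widehat V$ left and right singular vectors of $\widehat M$ for its $K$ largest singular values. There is a constant $c_0>0$, depending only on $d_1,d_2,C_1,C_2$, such that whenever $c_2,c_3,c_4\ge c_0$ are constants, $$\max\Big\{\min_{R}\|\widehat U-UR\|_F,\ \min_{R}\|\widehat V-VR\|_F\Big\}=O_p\Big(\frac{\mathcal R}{\lambda_{\min}}\Big),$$ the minima being over orthogonal $K\times K$ matrices $R$. -/

import Mathlib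

open MeasureTheory ProbabilityTheory Filter Topology
open scoped Matrix ENNReal

noncomputable section

namespace SideInfo

universe u

/-! ### Matrix notions -/

/-- Frobenius norm. -/
def frobNorm {m n : Type*} [Fintype m] [Fintype n] (A : Matrix m n ℝ) : ℝ :=
  Real.sqrt (∑ i, ∑ j, A i j ^ 2)

/-- The `k`-th largest singular value of `A` (counted from `k = 0`, with multiplicity; it is `0`
once `k` reaches the number of columns). -/
def singularValue {m n : Type*} [Fintype m] [Fintype n] [DecidableEq n]
    (A : Matrix m n ℝ) (k : ℕ) : ℝ :=
  (Matrix.toEuclideanLin A).singularValues k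

/-- Nuclear norm: the sum of the singular values. -/
def nuclearNorm {m n : Type*} [Fintype m] [Fintype n] [DecidableEq n]
    (A : Matrix m n ℝ) : ℝ :=
  ∑ k ∈ Finset.range (Fintype.card n), singularValue A k

/-- The smallest nonzero singular value (for `A = 0`, which has none, the value is `0`). -/
def minNonzeroSingularValue {m n : Type*} [Fintype m] [Fintype n] [DecidableEq n]
    (A : Matrix m n ℝ) : ℝ :=
  sInf {s : ℝ | 0 < s ∧ ∃ k : ℕ, s = singularValue A k}

/-- The orthogonal projection matrix `Φ (Φᵀ Φ)⁻¹ Φᵀ`. -/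
def projMatrix {m n : Type*} [Fintype m] [Fintype n] [DecidableEq n]
    (Φ : Matrix m n ℝ) : Matrix m m ℝ :=
  Φ * (Φᵀ * Φ)⁻¹ * Φᵀ

/-- `U` and `V` consist of left and right singular vectors of `A` for its `K` largest singular
values. -/
structure IsTopSingularVectors {N T K : ℕ} (A : Matrix (Fin N) (Fin T) ℝ)
    (U : Matrix (Fin N) (Fin K) ℝ) (V : Matrix (Fin T) (Fin K) ℝ) : Prop where
  orthonormal_left : Uᵀ * U = 1
  orthonormal_right : Vᵀ * V = 1
  mul_right : A * V = U * Matrix.diagonal (fun k : Fin K => singularValue A k)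
  mul_left : Aᵀ * U = V * Matrix.diagonal (fun k : Fin K => singularValue A k)

/-- `min_R ‖Uhat - U R‖_F` over orthogonal `K × K` matrices `R` (the infimum is over a compact
nonempty set, hence a minimum). -/
def rotationDist {N K : ℕ} (Uhat U : Matrix (Fin N) (Fin K) ℝ) : ℝ :=
  ⨅ R : Matrix.orthogonalGroup (Fin K) ℝ, frobNorm (Uhat - U * (R : Matrix (Fin K) (Fin K) ℝ))

/-- `Ahat` minimizes `‖B - A‖_F ^ 2 + ν ‖A‖_*` over all matrices `A`. -/
def IsNuclearMinimizer {N T : ℕ} (B : Matrix (Fin N) (Fin T) ℝ) (ν : ℝ)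
    (Ahat : Matrix (Fin N) (Fin T) ℝ) : Prop :=
  ∀ A : Matrix (Fin N) (Fin T) ℝ,
    frobNorm (B - Ahat) ^ 2 + ν * nuclearNorm Ahat ≤ frobNorm (B - A) ^ 2 + ν * nuclearNorm A

/-! ### Stochastic boundedness -/

/-- `Q n = O_p (r n)` as `n → ∞`. -/
def IsBigOp {Ω : Type*} [MeasurableSpace Ω] (μ : Measure Ω) (Q r : ℕ → Ω → ℝ) : Prop :=
  ∀ ε : ℝ, 0 < ε → ∃ C : ℝ, 0 < C ∧
    ∀ᶠ n in atTop, μ {ω | C * r n ω < |Q n ω|} ≤ ENNReal.ofReal ε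

/-! ### The model -/

/-- The data of the model along a sequence of problems indexed by `n`: dimensions, covariates,
component functions, unobserved factors, noise and basis functions, all of which may change
with `n`. -/
structure Model (Ω : Type u) [MeasurableSpace Ω] (d₁ d₂ : ℕ) where
  /-- number of rows -/
  N : ℕ → ℕ
  /-- number of columns -/
  T : ℕ → ℕ
  /-- sieve dimension -/
  J : ℕ → ℕ
  K₁ : ℕ → ℕ
  K₂ : ℕ → ℕ
  K₃ : ℕ → ℕ
  K₄ : ℕ → ℕ
  /-- row covariates `x_i` -/
  X : ∀ n, Ω → Fin (N n) → Fin d₁ → ℝ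
  /-- column covariates `z_t` -/
  Z : ∀ n, Ω → Fin (T n) → Fin d₂ → ℝ
  g₁ : ∀ n, Fin (K₁ n) → (Fin d₁ → ℝ) → ℝ
  g₂ : ∀ n, Fin (K₂ n) → (Fin d₁ → ℝ) → ℝ
  q₁ : ∀ n, Fin (K₁ n) → (Fin d₂ → ℝ) → ℝ
  q₂ : ∀ n, Fin (K₃ n) → (Fin d₂ → ℝ) → ℝ
  W₁ : ∀ n, Ω → Matrix (Fin (N n)) (Fin (K₃ n)) ℝ
  W₂ : ∀ n, Ω → Matrix (Fin (N n)) (Fin (K₄ n)) ℝ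
  V₁ : ∀ n, Ω → Matrix (Fin (T n)) (Fin (K₂ n)) ℝ
  V₂ : ∀ n, Ω → Matrix (Fin (T n)) (Fin (K₄ n)) ℝ
  /-- the noise matrix -/
  E : ∀ n, Ω → Matrix (Fin (N n)) (Fin (T n)) ℝ
  /-- basis functions for the rows -/
  φ : ∀ n, Fin (J n) → ℝ → ℝ
  /-- basis functions for the columns -/
  ψ : ∀ n, Fin (J n) → ℝ → ℝ
  measurable_X : ∀ n, Measurable (X n)
  measurable_Z : ∀ n, Measurable (Z n)
  measurable_g₁ : ∀ n k, Measurable (g₁ n k)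
  measurable_g₂ : ∀ n k, Measurable (g₂ n k)
  measurable_q₁ : ∀ n k, Measurable (q₁ n k)
  measurable_q₂ : ∀ n k, Measurable (q₂ n k)
  measurable_W₁ : ∀ n i k, Measurable (fun ω => W₁ n ω i k)
  measurable_W₂ : ∀ n i k, Measurable (fun ω => W₂ n ω i k)
  measurable_V₁ : ∀ n t k, Measurable (fun ω => V₁ n ω t k)
  measurable_V₂ : ∀ n t k, Measurable (fun ω => V₂ n ω t k)
  measurable_E : ∀ n i t, Measurable (fun ω => E n ω i t)
  measurable_φ : ∀ n j, Measurable (φ n j)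
  measurable_ψ : ∀ n j, Measurable (ψ n j)

namespace Model

variable {Ω : Type u} [MeasurableSpace Ω] {d₁ d₂ : ℕ} (S : Model Ω d₁ d₂)

def G₁ (n : ℕ) (ω : Ω) : Matrix (Fin (S.N n)) (Fin (S.K₁ n)) ℝ :=
  Matrix.of fun i k => S.g₁ n k (S.X n ω i)

def G₂ (n : ℕ) (ω : Ω) : Matrix (Fin (S.N n)) (Fin (S.K₂ n)) ℝ :=
  Matrix.of fun i k => S.g₂ n k (S.X n ω i)

def Q₁ (n : ℕ) (ω : Ω) : Matrix (Fin (S.T n)) (Fin (S.K₁ n)) ℝ :=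
  Matrix.of fun t k => S.q₁ n k (S.Z n ω t)

def Q₂ (n : ℕ) (ω : Ω) : Matrix (Fin (S.T n)) (Fin (S.K₃ n)) ℝ :=
  Matrix.of fun t k => S.q₂ n k (S.Z n ω t)

def M₁ (n : ℕ) (ω : Ω) : Matrix (Fin (S.N n)) (Fin (S.T n)) ℝ := S.G₁ n ω * (S.Q₁ n ω)ᵀ

def M₂ (n : ℕ) (ω : Ω) : Matrix (Fin (S.N n)) (Fin (S.T n)) ℝ := S.G₂ n ω * (S.V₁ n ω)ᵀ

def M₃ (n : ℕ) (ω : Ω) : Matrix (Fin (S.N n)) (Fin (S.T n)) ℝ := S.W₁ n ω * (S.Q₂ n ω)ᵀ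

def M₄ (n : ℕ) (ω : Ω) : Matrix (Fin (S.N n)) (Fin (S.T n)) ℝ := S.W₂ n ω * (S.V₂ n ω)ᵀ

/-- The matrix of interest. -/
def M (n : ℕ) (ω : Ω) : Matrix (Fin (S.N n)) (Fin (S.T n)) ℝ :=
  S.M₁ n ω + S.M₂ n ω + S.M₃ n ω + S.M₄ n ω

/-- The outcome matrix. -/
def Y (n : ℕ) (ω : Ω) : Matrix (Fin (S.N n)) (Fin (S.T n)) ℝ := S.M n ω + S.E n ω

/-- The vector `(φ_j (x_l))` of basis functions applied to each coordinate of `x`. -/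
def rowBasis (n : ℕ) (x : Fin d₁ → ℝ) : Fin d₁ × Fin (S.J n) → ℝ := fun p => S.φ n p.2 (x p.1)

/-- The vector `(ψ_j (z_l))` of basis functions applied to each coordinate of `z`. -/
def colBasis (n : ℕ) (z : Fin d₂ → ℝ) : Fin d₂ × Fin (S.J n) → ℝ := fun p => S.ψ n p.2 (z p.1)

/-- `Φ(X)`, with rows the basis vectors of the `x_i`. -/
def Phi (n : ℕ) (ω : Ω) : Matrix (Fin (S.N n)) (Fin d₁ × Fin (S.J n)) ℝ :=
  Matrix.of fun i => S.rowBasis n (S.X n ω i)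

/-- `Ψ(Z)`, with rows the basis vectors of the `z_t`. -/
def Psi (n : ℕ) (ω : Ω) : Matrix (Fin (S.T n)) (Fin d₂ × Fin (S.J n)) ℝ :=
  Matrix.of fun t => S.colBasis n (S.Z n ω t)

def PX (n : ℕ) (ω : Ω) : Matrix (Fin (S.N n)) (Fin (S.N n)) ℝ := projMatrix (S.Phi n ω)

def PZ (n : ℕ) (ω : Ω) : Matrix (Fin (S.T n)) (Fin (S.T n)) ℝ := projMatrix (S.Psi n ω)

/-- The union of the supports of the row covariates `x_i`. -/
def rowSupport (μ : Measure Ω) (n : ℕ) : Set (Fin d₁ → ℝ) :=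
  ⋃ i : Fin (S.N n), (μ.map (fun ω => S.X n ω i)).support

/-- The union of the supports of the column covariates `z_t`. -/
def colSupport (μ : Measure Ω) (n : ℕ) : Set (Fin d₂ → ℝ) :=
  ⋃ t : Fin (S.T n), (μ.map (fun ω => S.Z n ω t)).support

/-! ### Assumptions -/

/-- Independent, mean-zero, sub-Gaussian noise that is independent of `(X, Z)`. -/
structure NoiseAssumption (μ : Measure Ω) (C₁ C₂ : ℝ) : Prop where
  indep : ∀ n, iIndepFun (fun (p : Fin (S.N n) × Fin (S.T n)) ω => S.E n ω p.1 p.2) μ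
  mean_zero : ∀ n i t, Integrable (fun ω => S.E n ω i t) μ ∧ ∫ ω, S.E n ω i t ∂μ = 0
  subgaussian : ∃ σ : ℝ, σ ^ 2 ≤ C₁ ∧ ∀ n i t,
    (Integrable (fun ω => S.E n ω i t ^ 2) μ ∧ ∫ ω, S.E n ω i t ^ 2 ∂μ ≤ σ ^ 2) ∧
    ∀ s : ℝ, Integrable (fun ω => Real.exp (s * S.E n ω i t)) μ ∧
      ∫ ω, Real.exp (s * S.E n ω i t) ∂μ ≤ Real.exp (C₂ * s ^ 2 * σ ^ 2)
  indep_covariates : ∀ n, IndepFun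
    (fun ω (p : Fin (S.N n) × Fin (S.T n)) => S.E n ω p.1 p.2)
    (fun ω => (S.X n ω, S.Z n ω)) μ

/-- All the singular values of the `D × D` matrix `A` lie strictly between `c` and `C`, that is,
`c < λ_min(A) ≤ λ_max(A) < C`. -/
def SpectrumBetween {m : Type*} [Fintype m] [DecidableEq m] (A : Matrix m m ℝ) (c C : ℝ) : Prop :=
  ∀ k < Fintype.card m, c < singularValue A k ∧ singularValue A k < C

/-- Conditions on the basis functions: with probability approaching one the normalized Gram
matrices are well conditioned, and the basis functions have finite fourth moments. -/
structure BasisAssumption (μ : Measure Ω) : Prop where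
  gram : ∃ c C : ℝ, 0 < c ∧ 0 < C ∧
    Tendsto (fun n => μ {ω | ¬ (
      SpectrumBetween ((S.N n : ℝ)⁻¹ • ((S.Phi n ω)ᵀ * S.Phi n ω)) c C ∧
      SpectrumBetween ((S.T n : ℝ)⁻¹ • ((S.Psi n ω)ᵀ * S.Psi n ω)) c C)}) atTop (𝓝 0)
  moment_φ : ∀ n j i l, Integrable (fun ω => S.φ n j (S.X n ω i l) ^ 4) μ
  moment_ψ : ∀ n j t l, Integrable (fun ω => S.ψ n j (S.Z n ω t l) ^ 4) μ

/-- Sieve approximation of the functions `f n k` on the sets `D n` by linear combinations of the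
basis vectors, with error `O (J ^ (-γ))` uniformly in `k`. -/
def SieveApprox {d : ℕ} (J K : ℕ → ℕ) (f : ∀ n, Fin (K n) → (Fin d → ℝ) → ℝ)
    (basis : ∀ n, (Fin d → ℝ) → Fin d × Fin (J n) → ℝ) (D : ℕ → Set (Fin d → ℝ)) (γ : ℝ) : Prop :=
  ∃ b : ∀ n, Fin (K n) → Fin d × Fin (J n) → ℝ, ∃ C : ℝ, ∀ᶠ n in atTop, ∀ k, ∀ x ∈ D n,
    |f n k x - b n k ⬝ᵥ basis n x| ≤ C * (J n : ℝ) ^ (-γ)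

/-- Sieve approximation conditions. -/
structure SieveAssumption (μ : Measure Ω) (γ₁G γ₂G γ₁Q γ₂Q : ℝ) : Prop where
  two_le_γ₁G : 2 ≤ γ₁G
  two_le_γ₂G : 2 ≤ γ₂G
  two_le_γ₁Q : 2 ≤ γ₁Q
  two_le_γ₂Q : 2 ≤ γ₂Q
  approx_g₁ : SieveApprox S.J S.K₁ S.g₁ S.rowBasis (S.rowSupport μ) γ₁G
  approx_g₂ : SieveApprox S.J S.K₂ S.g₂ S.rowBasis (S.rowSupport μ) γ₂G
  approx_q₁ : SieveApprox S.J S.K₁ S.q₁ S.colBasis (S.colSupport μ) γ₁Q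
  approx_q₂ : SieveApprox S.J S.K₃ S.q₂ S.colBasis (S.colSupport μ) γ₂Q
  rate_g₁ : Tendsto (fun n => √(S.T n : ℝ) * S.K₁ n / (S.J n : ℝ) ^ γ₁G) atTop (𝓝 0)
  rate_q₁ : Tendsto (fun n => √(S.N n : ℝ) * S.K₁ n / (S.J n : ℝ) ^ γ₁Q) atTop (𝓝 0)
  rate_g₂ : Tendsto (fun n => max √(S.N n : ℝ) √(S.T n : ℝ) * S.K₂ n / (S.J n : ℝ) ^ γ₂G)
    atTop (𝓝 0)
  rate_q₂ : Tendsto (fun n => max √(S.N n : ℝ) √(S.T n : ℝ) * S.K₃ n / (S.J n : ℝ) ^ γ₂Q)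
    atTop (𝓝 0)

/-- The random variable `f` has second moment at most `C`. -/
def SecondMomentLE (μ : Measure Ω) (f : Ω → ℝ) (C : ℝ) : Prop :=
  Integrable (fun ω => f ω ^ 2) μ ∧ ∫ ω, f ω ^ 2 ∂μ ≤ C

/-- Moment conditions. -/
structure MomentAssumption (μ : Measure Ω) : Prop where
  moment_M : ∃ C : ℝ, ∀ n i t, Integrable (fun ω => S.M n ω i t ^ 4) μ ∧
    ∫ ω, S.M n ω i t ^ 4 ∂μ ≤ C
  moment_functions : ∃ C : ℝ, 0 < C ∧ ∀ n,
    (∀ i k, SecondMomentLE μ (fun ω => S.g₁ n k (S.X n ω i)) C) ∧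
    (∀ i k, SecondMomentLE μ (fun ω => S.g₂ n k (S.X n ω i)) C) ∧
    (∀ t k, SecondMomentLE μ (fun ω => S.q₁ n k (S.Z n ω t)) C) ∧
    (∀ t k, SecondMomentLE μ (fun ω => S.q₂ n k (S.Z n ω t)) C)
  moment_factors : ∃ C : ℝ, 0 < C ∧ ∀ n,
    (∀ i k, SecondMomentLE μ (fun ω => S.W₁ n ω i k) C) ∧
    (∀ i k, SecondMomentLE μ (fun ω => S.W₂ n ω i k) C) ∧
    (∀ t k, SecondMomentLE μ (fun ω => S.V₁ n ω t k) C) ∧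
    (∀ t k, SecondMomentLE μ (fun ω => S.V₂ n ω t k) C)

/-! ### The estimator and the rate -/

/-- `Mhat` is the estimator of `M` with penalties `ν₂ = c₂ √T`, `ν₃ = c₃ √N`, `ν₄ = c₄ √(N + T)`. -/
def IsEstimator (c₂ c₃ c₄ : ℝ) (n : ℕ) (ω : Ω) (Mhat : Matrix (Fin (S.N n)) (Fin (S.T n)) ℝ) :
    Prop :=
  ∃ Mhat₂ Mhat₃ Mhat₄ : Matrix (Fin (S.N n)) (Fin (S.T n)) ℝ,
    IsNuclearMinimizer (S.PX n ω * S.Y n ω * (1 - S.PZ n ω)) (c₂ * √(S.T n : ℝ)) Mhat₂ ∧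
    IsNuclearMinimizer ((1 - S.PX n ω) * S.Y n ω * S.PZ n ω) (c₃ * √(S.N n : ℝ)) Mhat₃ ∧
    IsNuclearMinimizer ((1 - S.PX n ω) * S.Y n ω * (1 - S.PZ n ω))
      (c₄ * √((S.N n : ℝ) + S.T n)) Mhat₄ ∧
    Mhat = S.PX n ω * S.Y n ω * S.PZ n ω + Mhat₂ + Mhat₃ + Mhat₄

/-- The rate `ℛ`. -/
def rate (γ₁G γ₂G γ₁Q γ₂Q : ℝ) (n : ℕ) (ω : Ω) : ℝ :=
  (S.J n : ℝ)
  + √((S.K₂ n : ℝ) + S.K₄ n) *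
      min √(S.T n : ℝ) (frobNorm (S.M₂ n ω) + frobNorm (S.PX n ω * S.M₄ n ω))
  + √((S.K₃ n : ℝ) + S.K₄ n) *
      min √(S.N n : ℝ) (frobNorm (S.M₃ n ω) + frobNorm (S.M₄ n ω * S.PZ n ω))
  + √(S.K₄ n : ℝ) * min √((S.N n : ℝ) + S.T n) (frobNorm (S.M₄ n ω))
  + √((S.N n : ℝ) * S.T n) *
      (S.K₁ n / (S.J n : ℝ) ^ γ₁G + S.K₁ n / (S.J n : ℝ) ^ γ₁Q
        + S.K₂ n / (S.J n : ℝ) ^ γ₂G + S.K₃ n / (S.J n : ℝ) ^ γ₂Q)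

/-- `ℛ / λ_min`, with `λ_min` the smallest nonzero singular value of `M`. -/
def relRate (γ₁G γ₂G γ₁Q γ₂Q : ℝ) (n : ℕ) (ω : Ω) : ℝ :=
  S.rate γ₁G γ₂G γ₁Q γ₂Q n ω / minNonzeroSingularValue (S.M n ω)

end Model

end SideInfo

end

/-!
The proof bounds `‖Mhat - M‖_F` by a constant times the rate `ℛ`, with probability close to one, and
then perturbs the singular vectors of `M`.

*Perturbation.* If `4 ‖A - M‖_F ≤ λ_min`, the first `K = rank M` singular values of `A` are at least
`λ_min / 2` (`le_singularValue`, a dimension count). As `U Uᵀ M = M`, the part of `Uhat` outside of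
the span of `U` has Frobenius norm at most `2 ‖A - M‖_F / λ_min` (`frobNorm_sinTheta_le`), and the
polar factor of `Uᵀ Uhat` is a rotation realizing this up to a factor `√2` (`rotationDist_sq_le`).
Together this is `rotationDist_le`. Its gap condition holds with probability tending to one because
`ℛ / λ_min → 0` in probability.

*Error bound.* The estimator splits `Y` into four blocks by `P_X` and `P_Z`. In `P_X Y P_Z` the
only error is the noise `P_X E P_Z`, which acts between spaces of dimension `O(J)`, so that its
operator norm is `O_p(√J)` and its Frobenius norm `O_p(J)`. Each other block is a low rank signal `L` plus a sieve
approximation error plus noise, and the penalty `ν` dominates twice the operator norm of the last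
two. Comparing the minimizer with `L` (decomposability of the nuclear norm) and with `0` bounds the
error by `3 ν √(rank L)` and by `3 ‖L‖_F` (`IsNuclearMinimizer.frobNorm_sub_le`), which are the two
terms of the minima in `ℛ`. The blocks are put together in `frobNorm_estimator_sub_le`.

*Noise.* For fixed projections `P`, `Q` of ranks `a`, `b`, a pair of `1/2`-nets with at most
`5 ^ (a + b)` pairs of points and the Chernoff bound for `uᵀ E v` control `‖P E Q‖`
(`measure_opNorm_proj_gt_le`). Projections depending on the covariates are handled by Fubini, as the
noise is independent of the covariates (`measure_opNorm_indep_proj_gt_le`). Invertibility of the Gram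
matrices forces `d₁ J ≤ N` and `d₂ J ≤ T`, so the dimensions of the three penalized blocks are
`O(T)`, `O(N)` and `O(N + T)` with constants depending on `d₁`, `d₂` only; this is why the threshold
`penaltyThreshold` depends on nothing else than `d₁, d₂, C₁, C₂`.

*Sieve.* `1 - P_X` annihilates the sieve part of `G₁(X)` and `G₂(X)`, and `1 - P_Z` that of `Q₁(Z)`
and `Q₂(Z)`; what is left is `O(J ^ (-γ))` in each entry, and the other factor is bounded by Markov's
inequality (`holdsWithProb_sieve_le`).
-/

noncomputable section

namespace SideInfo

open scoped Matrix.Norms.L2Operator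

/-! ### Frobenius and operator norms -/

section Frobenius

variable {m n l : Type*} [Fintype m] [Fintype n] [Fintype l]

lemma frobNorm_nonneg (A : Matrix m n ℝ) : 0 ≤ frobNorm A := Real.sqrt_nonneg _

lemma frobNorm_sq (A : Matrix m n ℝ) : frobNorm A ^ 2 = ∑ i, ∑ j, A i j ^ 2 :=
  Real.sq_sqrt (by positivity)

lemma trace_transpose_mul (A B : Matrix m n ℝ) : (Aᵀ * B).trace = ∑ i, ∑ j, A i j * B i j := by
  simp only [Matrix.trace, Matrix.diag, Matrix.mul_apply, Matrix.transpose_apply]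
  exact Finset.sum_comm

lemma frobNorm_sq_eq_trace (A : Matrix m n ℝ) : frobNorm A ^ 2 = (Aᵀ * A).trace := by
  rw [frobNorm_sq, trace_transpose_mul]
  simp only [sq]

lemma frobNorm_transpose (A : Matrix m n ℝ) : frobNorm Aᵀ = frobNorm A := by
  unfold frobNorm
  rw [Finset.sum_comm]
  rfl

lemma frobNorm_neg (A : Matrix m n ℝ) : frobNorm (-A) = frobNorm A := by
  simp [frobNorm]

/-- Cauchy–Schwarz for the Frobenius inner product. -/
lemma abs_trace_le (A B : Matrix m n ℝ) :
    |(Aᵀ * B).trace| ≤ frobNorm A * frobNorm B := by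
  rw [trace_transpose_mul]
  apply abs_le_of_sq_le_sq _ (mul_nonneg (frobNorm_nonneg A) (frobNorm_nonneg B))
  rw [mul_pow, frobNorm_sq, frobNorm_sq]
  simp only [← Fintype.sum_prod_type']
  exact Finset.sum_mul_sq_le_sq_mul_sq Finset.univ (fun p : m × n => A p.1 p.2) fun p => B p.1 p.2

lemma trace_le (A B : Matrix m n ℝ) : (Aᵀ * B).trace ≤ frobNorm A * frobNorm B :=
  (le_abs_self _).trans (abs_trace_le A B)

lemma frobNorm_add_sq (A B : Matrix m n ℝ) :
    frobNorm (A + B) ^ 2 = frobNorm A ^ 2 + 2 * (Aᵀ * B).trace + frobNorm B ^ 2 := by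
  rw [frobNorm_sq, frobNorm_sq, frobNorm_sq, trace_transpose_mul, Finset.mul_sum,
    ← Finset.sum_add_distrib, ← Finset.sum_add_distrib]
  refine Finset.sum_congr rfl fun i _ => ?_
  rw [Finset.mul_sum, ← Finset.sum_add_distrib, ← Finset.sum_add_distrib]
  refine Finset.sum_congr rfl fun j _ => ?_
  simp only [Matrix.add_apply]
  ring

lemma frobNorm_add_le (A B : Matrix m n ℝ) : frobNorm (A + B) ≤ frobNorm A + frobNorm B := by
  apply le_of_sq_le_sq _ (add_nonneg (frobNorm_nonneg A) (frobNorm_nonneg B))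
  rw [frobNorm_add_sq]
  nlinarith [trace_le A B]

lemma frobNorm_sub_le (A B : Matrix m n ℝ) : frobNorm (A - B) ≤ frobNorm A + frobNorm B := by
  rw [sub_eq_add_neg, ← frobNorm_neg B]
  exact frobNorm_add_le _ _

lemma frobNorm_mul_le (A : Matrix m n ℝ) (B : Matrix n l ℝ) :
    frobNorm (A * B) ≤ frobNorm A * frobNorm B := by
  apply le_of_sq_le_sq _ (mul_nonneg (frobNorm_nonneg A) (frobNorm_nonneg B))
  rw [mul_pow, frobNorm_sq, frobNorm_sq, ← frobNorm_transpose B, frobNorm_sq, Finset.sum_mul_sum]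
  refine Finset.sum_le_sum fun i _ => Finset.sum_le_sum fun j _ => ?_
  rw [Matrix.mul_apply]
  exact Finset.sum_mul_sq_le_sq_mul_sq _ _ _

lemma opNorm_transpose [DecidableEq m] [DecidableEq n] (A : Matrix m n ℝ) : ‖Aᵀ‖ = ‖A‖ := by
  rw [← Matrix.conjTranspose_eq_transpose_of_trivial, Matrix.l2_opNorm_conjTranspose]

lemma mulVec_dotProduct_le [DecidableEq n] (A : Matrix m n ℝ) (x : n → ℝ) :
    (A *ᵥ x) ⬝ᵥ (A *ᵥ x) ≤ ‖A‖ ^ 2 * (x ⬝ᵥ x) := by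
  have h := Matrix.l2_opNorm_mulVec A (WithLp.toLp 2 x)
  have h2 := pow_le_pow_left₀ (norm_nonneg _) h 2
  rw [mul_pow, EuclideanSpace.norm_sq_eq, EuclideanSpace.norm_sq_eq] at h2
  simpa [dotProduct, sq] using h2

lemma opNorm_le_of_forall [DecidableEq n] {A : Matrix m n ℝ} {c : ℝ} (hc : 0 ≤ c)
    (h : ∀ x : n → ℝ, (A *ᵥ x) ⬝ᵥ (A *ᵥ x) ≤ c ^ 2 * (x ⬝ᵥ x)) : ‖A‖ ≤ c := by
  rw [Matrix.l2_opNorm_def]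
  refine ContinuousLinearMap.opNorm_le_bound _ hc fun x => ?_
  apply le_of_sq_le_sq _ (by positivity)
  rw [mul_pow, EuclideanSpace.norm_sq_eq, EuclideanSpace.norm_sq_eq]
  have := h x.ofLp
  simpa [dotProduct, sq] using this

lemma frobNorm_mul_le_opNorm_mul [DecidableEq n] (A : Matrix m n ℝ) (B : Matrix n l ℝ) :
    frobNorm (A * B) ≤ ‖A‖ * frobNorm B := by
  apply le_of_sq_le_sq _ (mul_nonneg (norm_nonneg A) (frobNorm_nonneg B))
  rw [mul_pow, ← frobNorm_transpose, ← frobNorm_transpose B, frobNorm_sq, frobNorm_sq,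
    Finset.mul_sum]
  refine Finset.sum_le_sum fun j _ => ?_
  have := mulVec_dotProduct_le A (fun i => B i j)
  simpa [dotProduct, sq, Matrix.mul_apply, Matrix.mulVec] using this

lemma frobNorm_mul_le_mul_opNorm [DecidableEq n] [DecidableEq l] (A : Matrix m n ℝ)
    (B : Matrix n l ℝ) :
    frobNorm (A * B) ≤ frobNorm A * ‖B‖ := by
  rw [← frobNorm_transpose, Matrix.transpose_mul, ← frobNorm_transpose A, ← opNorm_transpose B,
    mul_comm]
  exact frobNorm_mul_le_opNorm_mul _ _

lemma opNorm_le_frobNorm [DecidableEq n] (A : Matrix m n ℝ) : ‖A‖ ≤ frobNorm A := by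
  refine opNorm_le_of_forall (frobNorm_nonneg A) fun x => ?_
  rw [frobNorm_sq, Finset.sum_mul]
  refine Finset.sum_le_sum fun i _ => ?_
  rw [← sq]
  refine (Finset.sum_mul_sq_le_sq_mul_sq Finset.univ (A i) x).trans_eq ?_
  simp [dotProduct, sq]

/-- A symmetric idempotent matrix is a contraction. -/
lemma opNorm_le_one_of_proj [DecidableEq m] {P : Matrix m m ℝ} (hs : Pᵀ = P) (hi : P * P = P) : ‖P‖ ≤ 1 := by
  have h := Matrix.l2_opNorm_conjTranspose_mul_self P
  rw [Matrix.conjTranspose_eq_transpose_of_trivial, hs, hi] at h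
  nlinarith [norm_nonneg P]

lemma one_sub_proj [DecidableEq m] {P : Matrix m m ℝ} (hs : Pᵀ = P) (hi : P * P = P) :
    (1 - P)ᵀ = 1 - P ∧ (1 - P) * (1 - P) = 1 - P := by
  constructor
  · simp [hs]
  · simp [mul_sub, sub_mul, hi]

end Frobenius

/-! ### Singular values, nuclear norm and nuclear norm regularization -/

lemma singularValue_nonneg {N T : ℕ} (A : Matrix (Fin N) (Fin T) ℝ) (k : ℕ) :
    0 ≤ singularValue A k := LinearMap.singularValues_nonneg _ _

lemma finrank_range_toEuclideanLin {m n : Type*} [Fintype m] [Fintype n] [DecidableEq m]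
    [DecidableEq n] (A : Matrix m n ℝ) :
    Module.finrank ℝ (Matrix.toEuclideanLin A).range = A.rank := by
  rw [Matrix.rank_eq_finrank_range_toLin A (EuclideanSpace.basisFun m ℝ).toBasis
    (EuclideanSpace.basisFun n ℝ).toBasis, Matrix.toEuclideanLin_eq_toLin_orthonormal]

lemma singularValue_pos_iff {m n : Type*} [Fintype m] [Fintype n] [DecidableEq m]
    [DecidableEq n] (A : Matrix m n ℝ) (k : ℕ) :
    0 < singularValue A k ↔ k < A.rank := by
  unfold singularValue
  rw [LinearMap.singularValues_pos_iff_lt_finrank_range, finrank_range_toEuclideanLin]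

lemma dotProduct_eq_inner {n : ℕ} (x y : EuclideanSpace ℝ (Fin n)) :
    x.ofLp ⬝ᵥ y.ofLp = inner ℝ x y := by
  simp [PiLp.inner_apply, dotProduct, mul_comm]

/-- Singular value decomposition: in an orthonormal basis `V` of the domain, the columns of `A * V`
are orthogonal with the singular values as their lengths. -/
lemma exists_svd {N T : ℕ} (A : Matrix (Fin N) (Fin T) ℝ) :
    ∃ V : Matrix (Fin T) (Fin T) ℝ, Vᵀ * V = 1 ∧ V * Vᵀ = 1 ∧
      (A * V)ᵀ * (A * V) = Matrix.diagonal fun k : Fin T => singularValue A k ^ 2 := by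
  set L := Matrix.toEuclideanLin A with hL
  have hn : Module.finrank ℝ (EuclideanSpace ℝ (Fin T)) = T := by simp
  set b := L.isSymmetric_adjoint_comp_self.eigenvectorBasis hn with hb
  set V : Matrix (Fin T) (Fin T) ℝ := Matrix.of fun i k => (b k).ofLp i with hV
  have h1 : Vᵀ * V = 1 := by
    ext i j
    have := (orthonormal_iff_ite.1 b.orthonormal) i j
    rw [← dotProduct_eq_inner] at this
    rw [Matrix.one_apply, ← this]
    rfl
  refine ⟨V, h1, mul_eq_one_comm.1 h1, ?_⟩
  have hcol : ∀ k, (fun i => (A * V) i k) = (L (b k)).ofLp := by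
    intro k
    ext i
    simp [hL, Matrix.mul_apply, hV, Matrix.mulVec, dotProduct, Matrix.toLpLin_apply]
  ext i j
  have : ((A * V)ᵀ * (A * V)) i j = (L (b i)).ofLp ⬝ᵥ (L (b j)).ofLp := by
    rw [← hcol, ← hcol]; rfl
  rw [this, dotProduct_eq_inner, ← LinearMap.adjoint_inner_right]
  have he : LinearMap.adjoint L (L (b j)) = (singularValue A j ^ 2) • b j := by
    have := L.isSymmetric_adjoint_comp_self.apply_eigenvectorBasis hn j
    unfold singularValue
    rw [← hL, L.sq_singularValues_fin hn j]
    exact this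
  rw [he, inner_smul_right, (orthonormal_iff_ite.1 b.orthonormal) i j, Matrix.diagonal_apply]
  split_ifs with h
  · subst h; simp
  · simp

section Nuclear

variable {N T : ℕ}

lemma nuclearNorm_eq (A : Matrix (Fin N) (Fin T) ℝ) :
    nuclearNorm A = ∑ k : Fin T, singularValue A k := by
  unfold nuclearNorm
  rw [Fintype.card_fin, Finset.sum_range]

/-- The nuclear norm is dominated by duality with the operator norm. -/
lemma trace_le_opNorm_mul_nuclearNorm (D A : Matrix (Fin N) (Fin T) ℝ) :
    (Dᵀ * A).trace ≤ ‖D‖ * nuclearNorm A := by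
  obtain ⟨V, h1, h2, h3⟩ := exists_svd A
  have e : (Dᵀ * A).trace = ((D * V)ᵀ * (A * V)).trace := by
    rw [Matrix.transpose_mul, Matrix.trace_mul_comm _ (A * V), Matrix.mul_assoc,
      ← Matrix.mul_assoc V, h2, Matrix.one_mul, Matrix.trace_mul_comm]
  rw [e, nuclearNorm_eq, Finset.mul_sum]
  refine Finset.sum_le_sum fun k _ => ?_
  have hk : ∑ i, (A * V) i k ^ 2 = singularValue A k ^ 2 := by
    have := congrFun (congrFun h3 k) k
    rw [Matrix.mul_apply, Matrix.diagonal_apply_eq] at this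
    simpa only [Matrix.transpose_apply, ← sq] using this
  have hv : ∑ i, V i k * V i k = 1 := by
    have := congrFun (congrFun h1 k) k
    simpa [Matrix.mul_apply] using this
  have hd : ∑ i, (D * V) i k ^ 2 ≤ ‖D‖ ^ 2 := by
    have := mulVec_dotProduct_le D (fun i => V i k)
    simp only [dotProduct, hv, mul_one] at this
    simpa only [sq, Matrix.mul_apply, Matrix.mulVec, dotProduct] using this
  apply le_of_sq_le_sq _ (mul_nonneg (norm_nonneg D) (singularValue_nonneg A k))
  rw [mul_pow, ← hk]
  exact (Finset.sum_mul_sq_le_sq_mul_sq Finset.univ (fun i => (D * V) i k)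
    (fun i => (A * V) i k)).trans (mul_le_mul_of_nonneg_right hd (by positivity))

/-- The polar part `W` of `A`: a partial isometry with initial space the row space of `A`, at which
the duality between operator and nuclear norm is attained. -/
lemma exists_polar (A : Matrix (Fin N) (Fin T) ℝ) :
    ∃ W : Matrix (Fin N) (Fin T) ℝ, W * Wᵀ * W = W ∧ (Wᵀ * A).trace = nuclearNorm A ∧
      A * (Wᵀ * W) = A ∧ frobNorm W ^ 2 ≤ A.rank := by
  obtain ⟨V, h1, h2, h3⟩ := exists_svd A
  set s : Fin T → ℝ := fun k => singularValue A k with hs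
  set B := A * V with hB
  have hBA : A = B * Vᵀ := by rw [hB, Matrix.mul_assoc, h2, Matrix.mul_one]
  set I : Matrix (Fin T) (Fin T) ℝ := Matrix.diagonal fun k => (s k)⁻¹ with hI
  set Z : Matrix (Fin T) (Fin T) ℝ := Matrix.diagonal fun k => if s k = 0 then 0 else 1 with hZ
  have hIt : Iᵀ = I := Matrix.diagonal_transpose _
  have hIZ : I * (Bᵀ * B) * I = Z := by
    rw [h3, hI, hZ, Matrix.diagonal_mul_diagonal, Matrix.diagonal_mul_diagonal]
    congr 1; ext k
    by_cases h : s k = 0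
    · simp [h]
    · have h' : singularValue A k ≠ 0 := h
      rw [if_neg h]; simp only [hs]; field_simp
  have hBZ : B * Z = B := by
    ext i k
    rw [hZ, Matrix.mul_diagonal]
    by_cases h : s k = 0
    · have hk : ∑ i, B i k * B i k = 0 := by
        have := congrFun (congrFun h3 k) k
        have h' : singularValue A k = 0 := h
        simpa [Matrix.mul_apply, h'] using this
      have := (Finset.sum_eq_zero_iff_of_nonneg (fun i _ => mul_self_nonneg _)).1 hk i
        (Finset.mem_univ i)
      simp [mul_self_eq_zero.1 this]
    · simp [h]
  have hZI : I * Z = I := by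
    rw [hI, hZ, Matrix.diagonal_mul_diagonal]
    congr 1; ext k
    by_cases h : s k = 0 <;> simp [h]
  have hW2 : (B * I * Vᵀ)ᵀ * (B * I * Vᵀ) = V * Z * Vᵀ := by
    rw [← hIZ]
    simp only [Matrix.transpose_mul, Matrix.transpose_transpose, hIt, Matrix.mul_assoc]
  refine ⟨B * I * Vᵀ, ?_, ?_, ?_, ?_⟩
  · rw [Matrix.mul_assoc, hW2]
    calc B * I * Vᵀ * (V * Z * Vᵀ) = B * (I * ((Vᵀ * V) * Z)) * Vᵀ := by
          simp only [Matrix.mul_assoc]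
      _ = _ := by rw [h1, Matrix.one_mul, hZI]
  · calc ((B * I * Vᵀ)ᵀ * A).trace = (V * (I * (Bᵀ * A))).trace := by
          simp only [Matrix.transpose_mul, Matrix.transpose_transpose, hIt, Matrix.mul_assoc]
      _ = (I * (Bᵀ * B)).trace := by
          rw [Matrix.trace_mul_comm]; simp only [Matrix.mul_assoc]; rw [hB]
      _ = nuclearNorm A := by
          rw [h3, hI, Matrix.diagonal_mul_diagonal, Matrix.trace_diagonal, nuclearNorm_eq]
          refine Finset.sum_congr rfl fun k _ => ?_
          by_cases h : singularValue A k = 0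
          · simp [hs, h]
          · simp only [hs]; field_simp
  · rw [hW2]
    calc A * (V * Z * Vᵀ) = (A * V) * Z * Vᵀ := by simp only [Matrix.mul_assoc]
      _ = A := by rw [← hB, hBZ, ← hBA]
  · rw [frobNorm_sq_eq_trace, hW2, Matrix.trace_mul_comm, ← Matrix.mul_assoc, h1, Matrix.one_mul,
      hZ, Matrix.trace_diagonal]
    have : ∀ k : Fin T, (if s k = 0 then (0:ℝ) else 1) = if (k : ℕ) < A.rank then 1 else 0 := by
      intro k
      have h4 := singularValue_pos_iff A k
      have h5 := singularValue_nonneg A k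
      by_cases h : s k = 0
      · have h' : singularValue A k = 0 := h
        rw [h'] at h4
        simp only [lt_self_iff_false, false_iff] at h4
        simp [h, h4]
      · have h' : (k : ℕ) < A.rank := h4.1 (lt_of_le_of_ne h5 (Ne.symm h))
        simp [h, h']
    simp_rw [this]
    rw [Finset.sum_boole]
    norm_cast
    calc _ ≤ (Finset.range A.rank).card := by
          apply Finset.card_le_card_of_injOn (fun k : Fin T => (k : ℕ))
          · intro k hk
            simpa using hk
          · exact fun a _ b _ h => Fin.ext h
      _ = A.rank := Finset.card_range _

lemma transpose_mul_self_proj {W : Matrix (Fin N) (Fin T) ℝ} (h : W * Wᵀ * W = W) :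
    (Wᵀ * W)ᵀ = Wᵀ * W ∧ (Wᵀ * W) * (Wᵀ * W) = Wᵀ * W := by
  constructor
  · simp
  · rw [Matrix.mul_assoc, ← Matrix.mul_assoc W, h]

lemma mul_transpose_self_proj {W : Matrix (Fin N) (Fin T) ℝ} (h : W * Wᵀ * W = W) :
    (W * Wᵀ)ᵀ = W * Wᵀ ∧ (W * Wᵀ) * (W * Wᵀ) = W * Wᵀ := by
  constructor
  · simp
  · rw [← Matrix.mul_assoc, h]

lemma opNorm_le_one_of_polar {W : Matrix (Fin N) (Fin T) ℝ} (h : W * Wᵀ * W = W) : ‖W‖ ≤ 1 := by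
  have h1 := opNorm_le_one_of_proj (transpose_mul_self_proj h).1 (transpose_mul_self_proj h).2
  have h2 := Matrix.l2_opNorm_conjTranspose_mul_self W
  rw [Matrix.conjTranspose_eq_transpose_of_trivial] at h2
  nlinarith [norm_nonneg W]

lemma nuclearNorm_nonneg (A : Matrix (Fin N) (Fin T) ℝ) : 0 ≤ nuclearNorm A :=
  Finset.sum_nonneg fun _ _ => singularValue_nonneg _ _

lemma nuclearNorm_zero : nuclearNorm (0 : Matrix (Fin N) (Fin T) ℝ) = 0 := by
  simp [nuclearNorm, singularValue]

lemma dotProduct_mulVec_mulVec {m n : Type*} [Fintype m] [Fintype n]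
    (A B : Matrix m n ℝ) (x : n → ℝ) :
    (A *ᵥ x) ⬝ᵥ (B *ᵥ x) = x ⬝ᵥ ((Aᵀ * B) *ᵥ x) := by
  rw [← Matrix.mulVec_mulVec, Matrix.dotProduct_mulVec x, Matrix.vecMul_transpose]

/-- Decomposability of the nuclear norm: moving away from `L` by `D` changes the nuclear norm by at
least the nuclear norm of the part `D'` of `D` that is orthogonal to the row and column spaces
of `L`, up to a term of the size `√(rank L) * ‖D‖_F`. -/
lemma nuclearNorm_decomposable (L D W : Matrix (Fin N) (Fin T) ℝ) (hW : W * Wᵀ * W = W)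
    (hWL : (Wᵀ * L).trace = nuclearNorm L) (hL : L * (Wᵀ * W) = L) :
    nuclearNorm L + nuclearNorm ((1 - W * Wᵀ) * D * (1 - Wᵀ * W)) - frobNorm W * frobNorm D
      ≤ nuclearNorm (L + D) := by
  set P := 1 - W * Wᵀ with hP
  set Q := 1 - Wᵀ * W with hQ
  obtain ⟨hPs, hPi⟩ := one_sub_proj (mul_transpose_self_proj hW).1 (mul_transpose_self_proj hW).2
  obtain ⟨hQs, hQi⟩ := one_sub_proj (transpose_mul_self_proj hW).1 (transpose_mul_self_proj hW).2
  rw [← hP] at hPs hPi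
  rw [← hQ] at hQs hQi
  obtain ⟨R, hR, hRD, -, -⟩ := exists_polar (P * D * Q)
  have hPW : Wᵀ * P = 0 := by
    have := congrArg Matrix.transpose hW
    simp only [Matrix.transpose_mul, Matrix.transpose_transpose] at this
    rw [hP, Matrix.mul_sub, Matrix.mul_one, this, sub_self]
  have hLQ : L * Q = 0 := by rw [hQ, Matrix.mul_sub, hL, Matrix.mul_one, sub_self]
  have hop : ‖W + P * R * Q‖ ≤ 1 := by
    refine opNorm_le_of_forall zero_le_one fun x => ?_
    have hR1 := opNorm_le_one_of_polar hR
    have hP1 := opNorm_le_one_of_proj hPs hPi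
    have e1 : (W *ᵥ x) ⬝ᵥ ((P * R * Q) *ᵥ x) = 0 := by
      rw [dotProduct_mulVec_mulVec, Matrix.mul_assoc, ← Matrix.mul_assoc, hPW]; simp
    have e2 : (W *ᵥ x) ⬝ᵥ (W *ᵥ x) + (Q *ᵥ x) ⬝ᵥ (Q *ᵥ x) = x ⬝ᵥ x := by
      rw [dotProduct_mulVec_mulVec, dotProduct_mulVec_mulVec, hQs, hQi, ← dotProduct_add,
        ← Matrix.add_mulVec, hQ, add_sub_cancel, Matrix.one_mulVec]
    have e3 : ((P * R * Q) *ᵥ x) ⬝ᵥ ((P * R * Q) *ᵥ x) ≤ (Q *ᵥ x) ⬝ᵥ (Q *ᵥ x) := by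
      rw [← Matrix.mulVec_mulVec]
      refine (mulVec_dotProduct_le _ _).trans ?_
      have hPR : ‖P * R‖ ≤ 1 := (Matrix.l2_opNorm_mul _ _).trans
        (mul_le_one₀ hP1 (norm_nonneg _) hR1)
      have h0 : 0 ≤ (Q *ᵥ x) ⬝ᵥ (Q *ᵥ x) := Finset.sum_nonneg fun _ _ => mul_self_nonneg _
      have : ‖P * R‖ ^ 2 ≤ 1 := pow_le_one₀ (norm_nonneg _) hPR
      nlinarith
    rw [Matrix.add_mulVec, dotProduct_add, add_dotProduct, add_dotProduct, e1,
      dotProduct_comm ((P * R * Q) *ᵥ x) (W *ᵥ x), e1]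
    linarith
  have h1 := trace_le_opNorm_mul_nuclearNorm (W + P * R * Q) (L + D)
  have h2 : ((W + P * R * Q)ᵀ * (L + D)).trace =
      nuclearNorm L + (Wᵀ * D).trace + nuclearNorm (P * D * Q) := by
    have e1 : ((P * R * Q)ᵀ * L).trace = 0 := by
      simp only [Matrix.transpose_mul, hQs, hPs]
      rw [Matrix.trace_mul_comm, ← Matrix.mul_assoc, hLQ]
      simp
    have e2 : ((P * R * Q)ᵀ * D).trace = (Rᵀ * (P * D * Q)).trace := by
      simp only [Matrix.transpose_mul, hQs, hPs]
      rw [Matrix.mul_assoc, Matrix.trace_mul_comm]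
      simp only [Matrix.mul_assoc]
    rw [Matrix.transpose_add, Matrix.add_mul, Matrix.mul_add, Matrix.mul_add, Matrix.trace_add,
      Matrix.trace_add, Matrix.trace_add, e1, e2, hWL, hRD]
    ring
  have h3 := (abs_le.1 (abs_trace_le W D)).1
  have h4 := nuclearNorm_nonneg (L + D)
  nlinarith

end Nuclear

section Minimizer

variable {N T : ℕ}

/-- The error of nuclear norm regularization when the penalty dominates the noise `Δ`. Comparison
with `L` gives the bound by the rank of `L`, comparison with `0` the bound by its size. -/
lemma IsNuclearMinimizer.frobNorm_sub_le {L Δ Ahat : Matrix (Fin N) (Fin T) ℝ} {ν : ℝ}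
    (h : IsNuclearMinimizer (L + Δ) ν Ahat) (hν : 2 * ‖Δ‖ ≤ ν) :
    frobNorm (Ahat - L) ≤ 3 * ν * √(L.rank : ℝ) ∧ frobNorm (Ahat - L) ≤ 3 * frobNorm L := by
  constructor
  · obtain ⟨W, hW, hWL, hL, hWr⟩ := exists_polar L
    set D := Ahat - L with hD
    have hA : Ahat = L + D := by rw [hD]; abel
    have hdec := nuclearNorm_decomposable L D W hW hWL hL
    set D' := (1 - W * Wᵀ) * D * (1 - Wᵀ * W) with hD'
    have hmin := h L
    have e1 : L + Δ - Ahat = Δ + -D := by rw [hA]; abel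
    rw [e1, frobNorm_add_sq, frobNorm_neg, add_sub_cancel_left, hA] at hmin
    have e2 : (Δᵀ * -D).trace = -(Δᵀ * D).trace := by simp
    rw [e2] at hmin
    -- The part of `D` that meets the row or column space of `L` has small rank.
    have e3 : D = D' + (W * Wᵀ) * D + (1 - W * Wᵀ) * D * (Wᵀ * W) := by
      rw [hD']; simp only [Matrix.sub_mul, Matrix.mul_sub, Matrix.one_mul, Matrix.mul_one]; abel
    have hP1 := opNorm_le_one_of_proj
      (one_sub_proj (mul_transpose_self_proj hW).1 (mul_transpose_self_proj hW).2).1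
      (one_sub_proj (mul_transpose_self_proj hW).1 (mul_transpose_self_proj hW).2).2
    have hW1 := opNorm_le_one_of_polar hW
    have fW := frobNorm_nonneg W
    have fD := frobNorm_nonneg D
    have nΔ := norm_nonneg Δ
    have b1 : (Δᵀ * ((W * Wᵀ) * D)).trace ≤ ‖Δ‖ * frobNorm W * frobNorm D := by
      have : Δᵀ * ((W * Wᵀ) * D) = ((W * Wᵀ) * Δ)ᵀ * D := by
        simp [Matrix.mul_assoc]
      rw [this]
      refine (trace_le _ _).trans (mul_le_mul_of_nonneg_right ?_ fD)
      refine (frobNorm_mul_le_mul_opNorm _ _).trans ?_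
      rw [mul_comm]
      refine mul_le_mul_of_nonneg_left ?_ nΔ
      refine (frobNorm_mul_le_mul_opNorm _ _).trans ?_
      rw [opNorm_transpose]
      nlinarith
    have b2 : (Δᵀ * ((1 - W * Wᵀ) * D * (Wᵀ * W))).trace ≤ ‖Δ‖ * frobNorm W * frobNorm D := by
      have : (Δᵀ * ((1 - W * Wᵀ) * D * (Wᵀ * W))).trace
          = ((Δ * (Wᵀ * W))ᵀ * ((1 - W * Wᵀ) * D)).trace := by
        rw [Matrix.transpose_mul, (transpose_mul_self_proj hW).1, Matrix.mul_assoc (Wᵀ * W),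
          Matrix.trace_mul_comm (Wᵀ * W)]
        simp only [Matrix.mul_assoc]
      rw [this]
      refine (trace_le _ _).trans (mul_le_mul ?_ ?_ (frobNorm_nonneg _) (by positivity))
      · refine (frobNorm_mul_le_opNorm_mul _ _).trans (mul_le_mul_of_nonneg_left ?_ nΔ)
        refine (frobNorm_mul_le_mul_opNorm _ _).trans ?_
        rw [frobNorm_transpose]
        nlinarith
      · refine (frobNorm_mul_le_opNorm_mul _ _).trans ?_
        nlinarith
    have b3 : (Δᵀ * D).trace ≤ ‖Δ‖ * nuclearNorm D' + 2 * (‖Δ‖ * frobNorm W * frobNorm D) := by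
      conv_lhs => rw [e3]
      rw [Matrix.mul_add, Matrix.mul_add, Matrix.trace_add, Matrix.trace_add]
      have := trace_le_opNorm_mul_nuclearNorm Δ D'
      linarith
    have hr : frobNorm W ≤ √(L.rank : ℝ) := Real.le_sqrt_of_sq_le hWr
    have nD' := nuclearNorm_nonneg D'
    have key : frobNorm D ^ 2 ≤ 3 * ν * frobNorm W * frobNorm D := by
      have i1 : ν * (nuclearNorm L + nuclearNorm D' - frobNorm W * frobNorm D)
          ≤ ν * nuclearNorm (L + D) := mul_le_mul_of_nonneg_left hdec (by linarith)
      have i2 : 2 * ‖Δ‖ * nuclearNorm D' ≤ ν * nuclearNorm D' :=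
        mul_le_mul_of_nonneg_right hν nD'
      have i3 : 2 * ‖Δ‖ * (frobNorm W * frobNorm D) ≤ ν * (frobNorm W * frobNorm D) :=
        mul_le_mul_of_nonneg_right hν (by positivity)
      nlinarith
    have hν0 : 0 ≤ ν := by linarith
    rcases fD.eq_or_lt with h0 | h0
    · rw [← h0]; positivity
    · have : frobNorm D ≤ 3 * ν * frobNorm W := by
        by_contra hc
        push Not at hc
        nlinarith
      exact this.trans (by gcongr)
  · have hmin := h 0
    rw [nuclearNorm_zero, sub_zero] at hmin
    have e1 : L + Δ - Ahat = (L + Δ) + -Ahat := by abel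
    rw [e1, frobNorm_add_sq, frobNorm_neg] at hmin
    have e2 : ((L + Δ)ᵀ * -Ahat).trace = -(Lᵀ * Ahat).trace - (Δᵀ * Ahat).trace := by
      simp [Matrix.add_mul]; ring
    rw [e2] at hmin
    have i1 := trace_le L Ahat
    have i2 := trace_le_opNorm_mul_nuclearNorm Δ Ahat
    have i3 : 2 * ‖Δ‖ * nuclearNorm Ahat ≤ ν * nuclearNorm Ahat :=
        mul_le_mul_of_nonneg_right hν (nuclearNorm_nonneg _)
    have key : frobNorm Ahat ^ 2 ≤ 2 * frobNorm L * frobNorm Ahat := by nlinarith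
    have : frobNorm Ahat ≤ 2 * frobNorm L := by
      by_contra hc
      push Not at hc
      nlinarith [frobNorm_nonneg L]
    linarith [SideInfo.frobNorm_sub_le Ahat L]

end Minimizer

/-! ### Perturbation of singular vectors -/

section Perturbation

variable {N T K : ℕ}

lemma opNorm_le_one_of_orthonormal {U : Matrix (Fin N) (Fin K) ℝ} (hU : Uᵀ * U = 1) : ‖U‖ ≤ 1 :=
  opNorm_le_one_of_polar (by rw [Matrix.mul_assoc, hU, Matrix.mul_one])

lemma orthonormal_proj {U : Matrix (Fin N) (Fin K) ℝ} (hU : Uᵀ * U = 1) :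
    (1 - U * Uᵀ)ᵀ = 1 - U * Uᵀ ∧ (1 - U * Uᵀ) * (1 - U * Uᵀ) = 1 - U * Uᵀ :=
  have h : U * Uᵀ * U = U := by rw [Matrix.mul_assoc, hU, Matrix.mul_one]
  one_sub_proj (mul_transpose_self_proj h).1 (mul_transpose_self_proj h).2

lemma rank_of_orthonormal {U : Matrix (Fin N) (Fin K) ℝ} (hU : Uᵀ * U = 1) : U.rank = K := by
  apply le_antisymm
  · simpa using U.rank_le_card_width
  · have := Matrix.rank_mul_le_right Uᵀ U
    rw [hU, Matrix.rank_one] at this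
    simpa using this

/-- Left singular vectors for all the nonzero singular values span the column space. -/
lemma mul_transpose_mul_of_rank_eq {M : Matrix (Fin N) (Fin T) ℝ} {U : Matrix (Fin N) (Fin K) ℝ}
    {V : Matrix (Fin T) (Fin K) ℝ} {s : Fin K → ℝ} (hU : Uᵀ * U = 1)
    (h : M * V = U * Matrix.diagonal s) (hs : ∀ k, s k ≠ 0) (hM : M.rank = K) :
    U * Uᵀ * M = M := by
  have hUM : U = M * (V * Matrix.diagonal fun k => (s k)⁻¹) := by
    rw [← Matrix.mul_assoc, h, Matrix.mul_assoc, Matrix.diagonal_mul_diagonal]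
    simp [hs]
  have hle : LinearMap.range U.mulVecLin ≤ LinearMap.range M.mulVecLin := by
    rintro _ ⟨x, rfl⟩
    refine ⟨(V * Matrix.diagonal fun k => (s k)⁻¹) *ᵥ x, ?_⟩
    simp only [Matrix.mulVecLin_apply]
    rw [Matrix.mulVec_mulVec, ← hUM]
  have heq : LinearMap.range U.mulVecLin = LinearMap.range M.mulVecLin := by
    apply Submodule.eq_of_le_of_finrank_eq hle
    exact (rank_of_orthonormal hU).trans hM.symm
  apply Matrix.ext_of_mulVec_single
  intro i
  have hi : M *ᵥ Pi.single i 1 ∈ LinearMap.range U.mulVecLin := by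
    rw [heq]; exact ⟨_, rfl⟩
  obtain ⟨y, hy⟩ := hi
  rw [Matrix.mulVecLin_apply] at hy
  rw [← Matrix.mulVec_mulVec, ← hy, Matrix.mulVec_mulVec, Matrix.mul_assoc, hU, Matrix.mul_one]

/-- A lower bound for the `k`-th singular value: `A` is bounded below by `σ` on a subspace of
dimension greater than `k`. -/
lemma le_singularValue {A : Matrix (Fin N) (Fin T) ℝ} {V : Matrix (Fin T) (Fin K) ℝ}
    (hV : Vᵀ * V = 1) {σ : ℝ}
    (h : ∀ x, σ ^ 2 * (x ⬝ᵥ x) ≤ ((A * V) *ᵥ x) ⬝ᵥ ((A * V) *ᵥ x)) {k : ℕ} (hk : k < K) :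
    σ ≤ singularValue A k := by
  obtain ⟨B, h1, h2, h3⟩ := exists_svd A
  have hKT : K ≤ T := by
    have := V.rank_le_card_height
    rwa [rank_of_orthonormal hV, Fintype.card_fin] at this
  by_contra hc
  push Not at hc
  -- By dimension count some nonzero vector of the subspace is orthogonal to the first `k`
  -- singular vectors.
  set f : (Fin K → ℝ) →ₗ[ℝ] (Fin k → ℝ) :=
    (LinearMap.funLeft ℝ ℝ fun i : Fin k => (⟨i, i.2.trans (hk.trans_le hKT)⟩ : Fin T)).comp
      (Bᵀ * V).mulVecLin with hf
  obtain ⟨x, hx, hx0⟩ := (Submodule.ne_bot_iff _).1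
    (LinearMap.ker_ne_bot_of_finrank_lt (f := f) (by simpa using hk))
  set y := (Bᵀ * V) *ᵥ x with hy
  have hy0 : ∀ j : Fin T, (j : ℕ) < k → y j = 0 := by
    intro j hj
    exact congrFun (LinearMap.mem_ker.1 hx) ⟨j, hj⟩
  have hyx : y ⬝ᵥ y = x ⬝ᵥ x := by
    rw [hy, dotProduct_mulVec_mulVec, Matrix.transpose_mul, Matrix.transpose_transpose,
      Matrix.mul_assoc, ← Matrix.mul_assoc B, h2, Matrix.one_mul, hV, Matrix.one_mulVec]
  have hAV : (A * V) *ᵥ x = (A * B) *ᵥ y := by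
    rw [hy, Matrix.mulVec_mulVec, Matrix.mul_assoc A, ← Matrix.mul_assoc B, h2, Matrix.one_mul]
  have hx1 : 0 < x ⬝ᵥ x := by
    have h0 : 0 ≤ x ⬝ᵥ x := Finset.sum_nonneg fun _ _ => mul_self_nonneg _
    refine lt_of_le_of_ne h0 fun he => hx0 (dotProduct_self_eq_zero.1 he.symm)
  have hle : ((A * V) *ᵥ x) ⬝ᵥ ((A * V) *ᵥ x) ≤ singularValue A k ^ 2 * (x ⬝ᵥ x) := by
    rw [hAV, dotProduct_mulVec_mulVec, h3, ← hyx, dotProduct, dotProduct, Finset.mul_sum]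
    refine Finset.sum_le_sum fun j _ => ?_
    rw [Matrix.mulVec_diagonal]
    by_cases hj : (j : ℕ) < k
    · simp [hy0 j hj]
    · have : singularValue A j ≤ singularValue A k :=
        LinearMap.singularValues_antitone _ (not_lt.1 hj)
      have h5 := pow_le_pow_left₀ (singularValue_nonneg A j) this 2
      nlinarith [mul_self_nonneg (y j)]
  have h6 := h x
  have h7 := singularValue_nonneg A k
  have : singularValue A k ^ 2 < σ ^ 2 := by nlinarith
  nlinarith

/-- Orthogonal Procrustes: the polar factor of `Uᵀ * Uhat` rotates `U` close to `Uhat` when the part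
of `Uhat` outside of the span of `U` is small. -/
lemma rotationDist_sq_le {U Uhat : Matrix (Fin N) (Fin K) ℝ} (hU : Uᵀ * U = 1)
    (hUhat : Uhatᵀ * Uhat = 1) (hθ : frobNorm ((1 - U * Uᵀ) * Uhat) < 1) :
    rotationDist Uhat U ^ 2 ≤ 2 * frobNorm ((1 - U * Uᵀ) * Uhat) ^ 2 := by
  set B := (1 - U * Uᵀ) * Uhat with hB
  set H := Uᵀ * Uhat with hH
  have hBB : Bᵀ * B = 1 - Hᵀ * H := by
    rw [hB, Matrix.transpose_mul, Matrix.mul_assoc, ← Matrix.mul_assoc (1 - U * Uᵀ)ᵀ,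
      (orthonormal_proj hU).1, (orthonormal_proj hU).2, Matrix.sub_mul, Matrix.mul_sub,
      Matrix.one_mul, hUhat, hH, Matrix.transpose_mul, Matrix.transpose_transpose]
    simp only [Matrix.mul_assoc]
  obtain ⟨W, hW, hWH, hHW, -⟩ := exists_polar H
  have hH1 : ‖H‖ ≤ 1 := by
    refine (Matrix.l2_opNorm_mul _ _).trans (mul_le_one₀ ?_ (norm_nonneg _)
      (opNorm_le_one_of_orthonormal hUhat))
    rw [opNorm_transpose]; exact opNorm_le_one_of_orthonormal hU
  have hunit : IsUnit H := by
    rw [← Matrix.mulVec_injective_iff_isUnit]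
    rw [← Matrix.coe_mulVecLin, ← LinearMap.ker_eq_bot, LinearMap.ker_eq_bot']
    intro x hx
    rw [Matrix.mulVecLin_apply] at hx
    have e1 : (B *ᵥ x) ⬝ᵥ (B *ᵥ x) = x ⬝ᵥ x := by
      rw [dotProduct_mulVec_mulVec, hBB, Matrix.sub_mulVec, Matrix.one_mulVec,
        ← Matrix.mulVec_mulVec, hx]
      simp
    have e2 := mulVec_dotProduct_le B x
    rw [e1] at e2
    have e3 : ‖B‖ < 1 := (opNorm_le_frobNorm B).trans_lt hθ
    have e4 : ‖B‖ ^ 2 < 1 := by nlinarith [norm_nonneg B]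
    have h0 : 0 ≤ x ⬝ᵥ x := Finset.sum_nonneg fun _ _ => mul_self_nonneg _
    exact dotProduct_self_eq_zero.1 (by nlinarith)
  have hW1 : Wᵀ * W = 1 := by
    have : H * (Wᵀ * W) = H * 1 := by rw [hHW, Matrix.mul_one]
    exact hunit.mul_left_cancel this
  have hWo : W ∈ Matrix.orthogonalGroup (Fin K) ℝ := by
    rw [Matrix.mem_orthogonalGroup_iff']
    exact hW1
  have hnuc : frobNorm H ^ 2 ≤ nuclearNorm H := by
    rw [frobNorm_sq_eq_trace]
    refine (trace_le_opNorm_mul_nuclearNorm H H).trans ?_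
    nlinarith [nuclearNorm_nonneg H]
  have hdist : rotationDist Uhat U ≤ frobNorm (Uhat - U * W) := by
    refine ciInf_le ⟨0, ?_⟩ (⟨W, hWo⟩ : Matrix.orthogonalGroup (Fin K) ℝ)
    rintro _ ⟨R, rfl⟩
    exact frobNorm_nonneg _
  have hnn : 0 ≤ rotationDist Uhat U := Real.iInf_nonneg fun R => frobNorm_nonneg _
  refine (pow_le_pow_left₀ hnn hdist 2).trans ?_
  have e0 : (Uhatᵀ * (U * W)).trace = nuclearNorm H := by
    rw [← hWH, hH, ← Matrix.trace_transpose]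
    simp only [Matrix.transpose_mul, Matrix.transpose_transpose, Matrix.mul_assoc]
  have e1 : frobNorm (Uhat - U * W) ^ 2 = 2 * K - 2 * nuclearNorm H := by
    rw [sub_eq_add_neg, frobNorm_add_sq, frobNorm_neg, frobNorm_sq_eq_trace, frobNorm_sq_eq_trace,
      hUhat, Matrix.transpose_mul, Matrix.mul_assoc, ← Matrix.mul_assoc Uᵀ, hU, Matrix.one_mul, hW1,
      Matrix.mul_neg, Matrix.trace_neg, e0, Matrix.trace_one, Fintype.card_fin]
    ring
  have e2 : frobNorm B ^ 2 = K - frobNorm H ^ 2 := by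
    rw [frobNorm_sq_eq_trace, frobNorm_sq_eq_trace, hBB, Matrix.trace_sub, Matrix.trace_one,
      Fintype.card_fin]
  rw [e1, e2]
  linarith

/-- The `sin Θ` bound: the estimated singular vectors `Uhat` of `A`, with singular values at least
`σ`, have a component outside of the column space of `M` of size at most `‖A - M‖_F / σ`. -/
lemma frobNorm_sinTheta_le {M A : Matrix (Fin N) (Fin T) ℝ} {U Uhat : Matrix (Fin N) (Fin K) ℝ}
    {Vhat : Matrix (Fin T) (Fin K) ℝ} {s : Fin K → ℝ} {σ : ℝ} (hU : Uᵀ * U = 1)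
    (hV : Vhatᵀ * Vhat = 1) (hM : U * Uᵀ * M = M) (hA : A * Vhat = Uhat * Matrix.diagonal s)
    (hσ : 0 ≤ σ) (hs : ∀ k, σ ≤ s k) :
    σ * frobNorm ((1 - U * Uᵀ) * Uhat) ≤ frobNorm (A - M) := by
  set B := (1 - U * Uᵀ) * Uhat with hB
  have e1 : B * Matrix.diagonal s = (1 - U * Uᵀ) * ((A - M) * Vhat) := by
    have h0 : (1 - U * Uᵀ) * M = 0 := by rw [Matrix.sub_mul, hM, Matrix.one_mul, sub_self]
    rw [hB, Matrix.mul_assoc, ← hA, Matrix.sub_mul A, Matrix.mul_sub (1 - U * Uᵀ),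
      ← Matrix.mul_assoc _ M, h0, Matrix.zero_mul, sub_zero]
  have e2 : σ * frobNorm B ≤ frobNorm (B * Matrix.diagonal s) := by
    apply le_of_sq_le_sq _ (frobNorm_nonneg _)
    rw [mul_pow, frobNorm_sq, frobNorm_sq, Finset.mul_sum]
    refine Finset.sum_le_sum fun i _ => ?_
    rw [Finset.mul_sum]
    refine Finset.sum_le_sum fun j _ => ?_
    rw [Matrix.mul_diagonal, mul_pow, mul_comm]
    exact mul_le_mul_of_nonneg_left (pow_le_pow_left₀ hσ (hs j) 2) (sq_nonneg _)
  refine e2.trans ?_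
  rw [e1]
  have h1 := frobNorm_mul_le_opNorm_mul (1 - U * Uᵀ) ((A - M) * Vhat)
  have h2 := frobNorm_mul_le_mul_opNorm (A - M) Vhat
  have h3 := opNorm_le_one_of_proj (orthonormal_proj hU).1 (orthonormal_proj hU).2
  have h4 := opNorm_le_one_of_orthonormal hV
  have h5 := frobNorm_nonneg ((A - M) * Vhat)
  have h6 := frobNorm_nonneg (A - M)
  nlinarith

lemma minNonzeroSingularValue_le {M : Matrix (Fin N) (Fin T) ℝ} {k : ℕ} (hk : k < M.rank) :
    minNonzeroSingularValue M ≤ singularValue M k :=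
  csInf_le ⟨0, fun _ h => h.1.le⟩ ⟨(singularValue_pos_iff M k).2 hk, k, rfl⟩

lemma minNonzeroSingularValue_pos {M : Matrix (Fin N) (Fin T) ℝ} (hM : M.rank ≠ 0) :
    0 < minNonzeroSingularValue M := by
  have hpos : 0 < singularValue M (M.rank - 1) := (singularValue_pos_iff M _).2 (by omega)
  refine hpos.trans_le (le_csInf ⟨_, hpos, _, rfl⟩ ?_)
  rintro _ ⟨hs, k, rfl⟩
  have := (singularValue_pos_iff M k).1 hs
  exact LinearMap.singularValues_antitone _ (by omega)

lemma minNonzeroSingularValue_nonneg (M : Matrix (Fin N) (Fin T) ℝ) :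
    0 ≤ minNonzeroSingularValue M := Real.sInf_nonneg fun _ h => h.1.le

/-- Perturbation of singular vectors (Wedin), in the form of distances up to rotation. -/
theorem rotationDist_le {M A : Matrix (Fin N) (Fin T) ℝ} {U Uhat : Matrix (Fin N) (Fin K) ℝ}
    {V Vhat : Matrix (Fin T) (Fin K) ℝ} (hM : M.rank = K) (h : IsTopSingularVectors M U V)
    (hhat : IsTopSingularVectors A Uhat Vhat)
    (hgap : K ≠ 0 → 4 * frobNorm (A - M) ≤ minNonzeroSingularValue M) :
    max (rotationDist Uhat U) (rotationDist Vhat V)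
      ≤ 3 * frobNorm (A - M) / minNonzeroSingularValue M := by
  set lam := minNonzeroSingularValue M with hlam
  have hδ := frobNorm_nonneg (A - M)
  rcases Nat.eq_zero_or_pos K with hK | hK
  · have h0 : ∀ {n : ℕ} (B C : Matrix (Fin n) (Fin K) ℝ), rotationDist B C ≤ 0 := by
      intro n B C
      subst hK
      refine (ciInf_le ⟨0, ?_⟩ (1 : Matrix.orthogonalGroup (Fin 0) ℝ)).trans ?_
      · rintro _ ⟨R, rfl⟩
        exact frobNorm_nonneg _
      · simp [frobNorm]
    have := minNonzeroSingularValue_nonneg M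
    exact (max_le (h0 _ _) (h0 _ _)).trans (by positivity)
  have hlam0 : 0 < lam := minNonzeroSingularValue_pos (by omega)
  replace hgap := hgap hK.ne'
  have hsM : ∀ k : Fin K, lam ≤ singularValue M k := fun k =>
    minNonzeroSingularValue_le (by rw [hM]; exact k.2)
  have hsM0 : ∀ k : Fin K, singularValue M k ≠ 0 := fun k => (hlam0.trans_le (hsM k)).ne'
  have hsA : ∀ k : Fin K, lam / 2 ≤ singularValue A k := by
    intro k
    refine le_singularValue h.orthonormal_right (fun x => ?_) k.2
    have e1 : lam ^ 2 * (x ⬝ᵥ x) ≤ ((M * V) *ᵥ x) ⬝ᵥ ((M * V) *ᵥ x) := by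
      rw [h.mul_right, ← Matrix.mulVec_mulVec, dotProduct_mulVec_mulVec, h.orthonormal_left,
        Matrix.one_mulVec, dotProduct, dotProduct, Finset.mul_sum]
      refine Finset.sum_le_sum fun j _ => ?_
      rw [Matrix.mulVec_diagonal]
      nlinarith [mul_self_nonneg (x j), pow_le_pow_left₀ hlam0.le (hsM j) 2]
    have e2 : (((A - M) * V) *ᵥ x) ⬝ᵥ (((A - M) * V) *ᵥ x) ≤ (lam / 4) ^ 2 * (x ⬝ᵥ x) := by
      refine (mulVec_dotProduct_le _ x).trans (mul_le_mul_of_nonneg_right ?_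
        (Finset.sum_nonneg fun _ _ => mul_self_nonneg _))
      refine pow_le_pow_left₀ (norm_nonneg _) ?_ 2
      have h1 := Matrix.l2_opNorm_mul (A - M) V
      have h2 := opNorm_le_one_of_orthonormal h.orthonormal_right
      have h3 := opNorm_le_frobNorm (A - M)
      nlinarith [norm_nonneg (A - M)]
    have e3 : ((M * V) *ᵥ x) ⬝ᵥ ((M * V) *ᵥ x) / 2 - (((A - M) * V) *ᵥ x) ⬝ᵥ (((A - M) * V) *ᵥ x)
        ≤ ((A * V) *ᵥ x) ⬝ᵥ ((A * V) *ᵥ x) := by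
      have : (A * V) *ᵥ x = (M * V) *ᵥ x + ((A - M) * V) *ᵥ x := by
        rw [← Matrix.add_mulVec, ← Matrix.add_mul, add_sub_cancel]
      rw [this]
      simp only [dotProduct, Finset.sum_div, ← Finset.sum_sub_distrib, Pi.add_apply]
      refine Finset.sum_le_sum fun j _ => ?_
      nlinarith [sq_nonneg (((M * V) *ᵥ x) j + 2 * (((A - M) * V) *ᵥ x) j)]
    have h0 : 0 ≤ x ⬝ᵥ x := Finset.sum_nonneg fun _ _ => mul_self_nonneg _
    nlinarith [mul_nonneg (sq_nonneg lam) h0]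
  have hUM := mul_transpose_mul_of_rank_eq h.orthonormal_left h.mul_right hsM0 hM
  have hVM := mul_transpose_mul_of_rank_eq h.orthonormal_right h.mul_left hsM0
    (by rw [Matrix.rank_transpose, hM])
  have hsinU := frobNorm_sinTheta_le h.orthonormal_left hhat.orthonormal_right hUM hhat.mul_right
    (by positivity) hsA
  have hsinV := frobNorm_sinTheta_le h.orthonormal_right hhat.orthonormal_left hVM hhat.mul_left
    (by positivity) hsA
  rw [← Matrix.transpose_sub, frobNorm_transpose] at hsinV
  have fin : ∀ {n : ℕ} {B C : Matrix (Fin n) (Fin K) ℝ}, Cᵀ * C = 1 → Bᵀ * B = 1 →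
      lam / 2 * frobNorm ((1 - C * Cᵀ) * B) ≤ frobNorm (A - M) →
      rotationDist B C ≤ 3 * frobNorm (A - M) / lam := by
    intro n B C hC hB hsin
    set θ := frobNorm ((1 - C * Cᵀ) * B) with hθ
    have hθ0 : 0 ≤ θ := frobNorm_nonneg _
    have hθ1 : θ < 1 := by nlinarith
    have h1 := rotationDist_sq_le hC hB hθ1
    rw [le_div_iff₀ hlam0]
    have h2 : rotationDist B C ≤ 3 / 2 * θ := by
      apply le_of_sq_le_sq _ (by positivity)
      nlinarith
    nlinarith
  exact max_le (fin h.orthonormal_left hhat.orthonormal_left hsinU)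
    (fin h.orthonormal_right hhat.orthonormal_right hsinV)

end Perturbation

/-! ### The operator norm of the noise -/

section Nets

/-- The unit ball of a normed space of dimension `d` has a `1/2`-net of at most `5 ^ d` points. -/
lemma exists_half_net (F : Type*) [NormedAddCommGroup F] [NormedSpace ℝ F]
    [FiniteDimensional ℝ F] :
    ∃ s : Finset F, (∀ c ∈ s, ‖c‖ ≤ 1) ∧ s.card ≤ 5 ^ Module.finrank ℝ F ∧
      ∀ u : F, ‖u‖ ≤ 1 → ∃ c ∈ s, ‖u - c‖ ≤ 1 / 2 := by
  classical
  set p : Finset F → Prop := fun s =>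
    (∀ c ∈ s, ‖c‖ ≤ 1) ∧ ∀ c ∈ s, ∀ d ∈ s, c ≠ d → 1 / 2 ≤ ‖c - d‖ with hp
  have hcard : ∀ s, p s → s.card ≤ 5 ^ Module.finrank ℝ F := by
    intro s hs
    have hinj : Function.Injective fun c : F => (2 : ℝ) • c := smul_right_injective F two_ne_zero
    rw [← Finset.card_image_of_injective s hinj]
    apply Besicovitch.card_le_of_separated
    · simp only [Finset.mem_image]
      rintro _ ⟨c, hc, rfl⟩
      rw [norm_smul, Real.norm_ofNat]
      linarith [hs.1 c hc]
    · simp only [Finset.mem_image]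
      rintro _ ⟨c, hc, rfl⟩ _ ⟨d, hd, rfl⟩ hcd
      rw [← smul_sub, norm_smul, Real.norm_ofNat]
      have := hs.2 c hc d hd (fun h => hcd (by rw [h]))
      linarith
  set A : Set ℕ := {k | ∃ s, p s ∧ s.card = k} with hA
  have hbdd : BddAbove A := ⟨5 ^ Module.finrank ℝ F, by rintro _ ⟨s, hs, rfl⟩; exact hcard s hs⟩
  have hne : A.Nonempty := ⟨0, ∅, by simp [hp], rfl⟩
  -- A maximal separated set is a net.
  obtain ⟨s, hs, hmax⟩ := Nat.sSup_mem hne hbdd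
  refine ⟨s, hs.1, hcard s hs, fun u hu => ?_⟩
  by_contra! hc
  have hus : u ∉ s := fun h => by
    have := hc u h
    norm_num at this
  have hins : p (insert u s) := by
    constructor
    · simpa using ⟨hu, hs.1⟩
    · intro c hcm d hdm hcd
      rcases Finset.mem_insert.1 hcm with rfl | hcs <;> rcases Finset.mem_insert.1 hdm with rfl | hds
      · exact absurd rfl hcd
      · exact (hc d hds).le
      · rw [norm_sub_rev]; exact (hc c hcs).le
      · exact hs.2 c hcs d hds hcd
  have : s.card + 1 ≤ s.card := by
    conv_rhs => rw [hmax]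
    exact le_csSup hbdd ⟨_, hins, Finset.card_insert_of_notMem hus⟩
  omega

/-- A finite `1/2`-net for the unit ball of the range of a projection matrix `P`. -/
lemma exists_half_net_range {N : ℕ} {P : Matrix (Fin N) (Fin N) ℝ} (hi : P * P = P) :
    ∃ s : Finset (EuclideanSpace ℝ (Fin N)), (∀ c ∈ s, ‖c‖ ≤ 1 ∧ Matrix.toEuclideanLin P c = c) ∧
      s.card ≤ 5 ^ P.rank ∧
      ∀ u, Matrix.toEuclideanLin P u = u → ‖u‖ ≤ 1 → ∃ c ∈ s, ‖u - c‖ ≤ 1 / 2 := by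
  classical
  obtain ⟨s, h1, h2, h3⟩ := exists_half_net (LinearMap.range (Matrix.toEuclideanLin P))
  refine ⟨s.image Subtype.val, ?_, ?_, ?_⟩
  · simp only [Finset.mem_image]
    rintro _ ⟨c, hc, rfl⟩
    refine ⟨h1 c hc, ?_⟩
    obtain ⟨x, hx⟩ := c.2
    rw [← hx, Matrix.toLpLin_apply, Matrix.toLpLin_apply, Matrix.mulVec_mulVec, hi]
  · rw [← finrank_range_toEuclideanLin]
    exact Finset.card_image_le.trans h2
  · intro u hu hu1
    obtain ⟨c, hc, hc'⟩ := h3 ⟨u, u, hu⟩ hu1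
    exact ⟨c, Finset.mem_image_of_mem _ hc, hc'⟩

/-- The operator norm of `P * E * Q` is controlled by the bilinear form of `E` on nets. -/
lemma opNorm_le_of_nets {N T : ℕ} {P : Matrix (Fin N) (Fin N) ℝ} {Q : Matrix (Fin T) (Fin T) ℝ}
    {E : Matrix (Fin N) (Fin T) ℝ} (hPs : Pᵀ = P) (hPi : P * P = P) (hQs : Qᵀ = Q)
    (hQi : Q * Q = Q) {s : Finset (EuclideanSpace ℝ (Fin N))}
    {t : Finset (EuclideanSpace ℝ (Fin T))} (hs : ∀ c ∈ s, Matrix.toEuclideanLin P c = c)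
    (hs' : ∀ u, Matrix.toEuclideanLin P u = u → ‖u‖ ≤ 1 → ∃ c ∈ s, ‖u - c‖ ≤ 1 / 2)
    (ht : ∀ c ∈ t, Matrix.toEuclideanLin Q c = c)
    (ht' : ∀ u, Matrix.toEuclideanLin Q u = u → ‖u‖ ≤ 1 → ∃ c ∈ t, ‖u - c‖ ≤ 1 / 2)
    {τ : ℝ} (hτ : 0 ≤ τ) (h : ∀ u ∈ s, ∀ v ∈ t, u.ofLp ⬝ᵥ (E *ᵥ v.ofLp) ≤ τ) :
    ‖P * E * Q‖ ≤ 4 * τ := by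
  set B := P * E * Q with hB
  have hBnorm : ∀ x : EuclideanSpace ℝ (Fin T), ‖Matrix.toEuclideanLin B x‖ ≤ ‖B‖ * ‖x‖ :=
    fun x => Matrix.l2_opNorm_mulVec B x
  have step1 : ∀ v ∈ t, ‖Matrix.toEuclideanLin B v‖ ≤ 2 * τ := by
    intro v hv
    set w := Matrix.toEuclideanLin B v with hw
    have hPw : Matrix.toEuclideanLin P w = w := by
      rw [hw, Matrix.toLpLin_apply, Matrix.toLpLin_apply, Matrix.mulVec_mulVec, hB,
        ← Matrix.mul_assoc, ← Matrix.mul_assoc, hPi]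
    rcases eq_or_ne w 0 with h0 | h0
    · rw [h0, norm_zero]; positivity
    have hn : 0 < ‖w‖ := norm_pos_iff.2 h0
    obtain ⟨c, hc, hcu⟩ := hs' (‖w‖⁻¹ • w) (by rw [map_smul, hPw])
      (by rw [norm_smul, norm_inv, norm_norm, inv_mul_cancel₀ hn.ne'])
    have e1 : inner ℝ (‖w‖⁻¹ • w) w = ‖w‖ := by
      rw [real_inner_smul_left, real_inner_self_eq_norm_sq]
      field_simp
    have e2 : inner ℝ (‖w‖⁻¹ • w - c) w ≤ 1 / 2 * ‖w‖ :=
      (real_inner_le_norm _ _).trans (mul_le_mul_of_nonneg_right hcu hn.le)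
    have e3 : inner ℝ c w = c.ofLp ⬝ᵥ (E *ᵥ v.ofLp) := by
      have hv' : Q *ᵥ v.ofLp = v.ofLp := by
        have := congrArg WithLp.ofLp (ht v hv)
        simpa [Matrix.toLpLin_apply] using this
      have hc' : P *ᵥ c.ofLp = c.ofLp := by
        have := congrArg WithLp.ofLp (hs c hc)
        simpa [Matrix.toLpLin_apply] using this
      have hw' : w.ofLp = P *ᵥ (E *ᵥ v.ofLp) := by
        rw [hw, Matrix.toLpLin_apply, hB, ← Matrix.mulVec_mulVec, hv', ← Matrix.mulVec_mulVec]
      rw [← dotProduct_eq_inner, hw', Matrix.dotProduct_mulVec, ← Matrix.mulVec_transpose, hPs, hc']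
    rw [inner_sub_left, e1, e3] at e2
    linarith [h c hc v hv]
  have step2 : ‖B‖ ≤ 2 * τ + ‖B‖ / 2 := by
    have hball : ∀ x : EuclideanSpace ℝ (Fin T), ‖x‖ ≤ 1 →
        ‖Matrix.toEuclideanLin B x‖ ≤ 2 * τ + ‖B‖ / 2 := by
      intro x hx
      set y := Matrix.toEuclideanLin Q x with hy
      have hQy : Matrix.toEuclideanLin Q y = y := by
        rw [hy, Matrix.toLpLin_apply, Matrix.toLpLin_apply, Matrix.mulVec_mulVec, hQi]
      have hy1 : ‖y‖ ≤ 1 := by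
        have := Matrix.l2_opNorm_mulVec Q x
        have hQ1 := opNorm_le_one_of_proj hQs hQi
        refine this.trans ?_
        nlinarith [norm_nonneg x]
      obtain ⟨c, hc, hcy⟩ := ht' y hQy hy1
      have hBy : Matrix.toEuclideanLin B x = Matrix.toEuclideanLin B c
          + Matrix.toEuclideanLin B (y - c) := by
        rw [← map_add, add_sub_cancel, hy, Matrix.toLpLin_apply, Matrix.toLpLin_apply,
          Matrix.toLpLin_apply, Matrix.mulVec_mulVec, hB, Matrix.mul_assoc (P * E), hQi]
      rw [hBy]
      refine (norm_add_le _ _).trans (add_le_add (step1 c hc) ((hBnorm _).trans ?_))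
      nlinarith [norm_nonneg B]
    have h0 : 0 ≤ 2 * τ + ‖B‖ / 2 := by positivity
    conv_lhs => rw [Matrix.l2_opNorm_def]
    refine ContinuousLinearMap.opNorm_le_of_unit_norm h0 fun x hx => ?_
    exact hball x hx.le
  linarith

end Nets

section Noise

variable {Ω : Type*} [MeasurableSpace Ω] {μ : Measure Ω} {N T : ℕ}

/-- Chernoff bound for the bilinear form of a matrix with independent sub-Gaussian entries. -/
lemma measure_bilin_ge_le [IsProbabilityMeasure μ] {E : Ω → Matrix (Fin N) (Fin T) ℝ} {c : NNReal}
    (hind : iIndepFun (fun (p : Fin N × Fin T) ω => E ω p.1 p.2) μ)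
    (hsub : ∀ i t, HasSubgaussianMGF (fun ω => E ω i t) c μ)
    {u : EuclideanSpace ℝ (Fin N)} {v : EuclideanSpace ℝ (Fin T)} (hu : ‖u‖ ≤ 1) (hv : ‖v‖ ≤ 1)
    {τ : ℝ} (hτ : 0 ≤ τ) :
    μ.real {ω | τ ≤ u.ofLp ⬝ᵥ (E ω *ᵥ v.ofLp)} ≤ Real.exp (-τ ^ 2 / (2 * c)) := by
  have h1 : HasSubgaussianMGF (fun ω => ∑ p : Fin N × Fin T, u p.1 * v p.2 * E ω p.1 p.2)
      (∑ p : Fin N × Fin T, Real.toNNReal ((u p.1 * v p.2) ^ 2) * c) μ := by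
    refine HasSubgaussianMGF.sum_of_iIndepFun
      (X := fun (p : Fin N × Fin T) ω => u p.1 * v p.2 * E ω p.1 p.2)
      (hind.comp (fun p x => u p.1 * v p.2 * x) fun p => by fun_prop) fun p _ => ?_
    have h := (hsub p.1 p.2).const_mul (u p.1 * v p.2)
    rwa [show (⟨(u p.1 * v p.2) ^ 2, sq_nonneg _⟩ : NNReal) = Real.toNNReal ((u p.1 * v p.2) ^ 2)
      from (Real.toNNReal_of_nonneg (sq_nonneg _)).symm] at h
  have h2 : (((∑ p : Fin N × Fin T, Real.toNNReal ((u p.1 * v p.2) ^ 2) * c) : NNReal) : ℝ) ≤ c := by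
    have : (((∑ p : Fin N × Fin T, Real.toNNReal ((u p.1 * v p.2) ^ 2) * c) : NNReal) : ℝ)
        = ‖u‖ ^ 2 * ‖v‖ ^ 2 * c := by
      push_cast
      simp only [Real.coe_toNNReal _ (sq_nonneg _)]
      rw [← Finset.sum_mul, EuclideanSpace.real_norm_sq_eq, EuclideanSpace.real_norm_sq_eq,
        Finset.sum_mul_sum, Fintype.sum_prod_type]
      simp only [mul_pow]
    rw [this]
    have h3 : ‖u‖ ^ 2 * ‖v‖ ^ 2 ≤ 1 :=
      mul_le_one₀ (pow_le_one₀ (norm_nonneg _) hu) (by positivity) (pow_le_one₀ (norm_nonneg _) hv)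
    nlinarith [c.2]
  have h3 : HasSubgaussianMGF (fun ω => ∑ p : Fin N × Fin T, u p.1 * v p.2 * E ω p.1 p.2) c μ := by
    refine ⟨h1.integrable_exp_mul, fun t => (h1.mgf_le t).trans ?_⟩
    refine Real.exp_le_exp.2 ?_
    have := sq_nonneg t
    gcongr
  have h4 : ∀ ω, u.ofLp ⬝ᵥ (E ω *ᵥ v.ofLp) = ∑ p : Fin N × Fin T, u p.1 * v p.2 * E ω p.1 p.2 := by
    intro ω
    simp only [dotProduct, Matrix.mulVec, Finset.mul_sum, Fintype.sum_prod_type]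
    refine Finset.sum_congr rfl fun i _ => Finset.sum_congr rfl fun j _ => ?_
    ring
  simp_rw [h4]
  exact h3.measure_ge_le hτ

/-- Tail bound for the operator norm of the noise, compressed by fixed projections. -/
lemma measure_opNorm_proj_gt_le [IsProbabilityMeasure μ] {E : Ω → Matrix (Fin N) (Fin T) ℝ}
    {c : NNReal} (hind : iIndepFun (fun (p : Fin N × Fin T) ω => E ω p.1 p.2) μ)
    (hsub : ∀ i t, HasSubgaussianMGF (fun ω => E ω i t) c μ)
    {P : Matrix (Fin N) (Fin N) ℝ} {Q : Matrix (Fin T) (Fin T) ℝ} (hPs : Pᵀ = P) (hPi : P * P = P)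
    (hQs : Qᵀ = Q) (hQi : Q * Q = Q) {τ : ℝ} (hτ : 0 ≤ τ) :
    μ {ω | 4 * τ < ‖P * E ω * Q‖}
      ≤ ENNReal.ofReal (5 ^ (P.rank + Q.rank) * Real.exp (-τ ^ 2 / (2 * c))) := by
  obtain ⟨s, hs1, hs2, hs3⟩ := exists_half_net_range hPi
  obtain ⟨t, ht1, ht2, ht3⟩ := exists_half_net_range hQi
  have hsubset : {ω | 4 * τ < ‖P * E ω * Q‖} ⊆
      ⋃ p ∈ s ×ˢ t, {ω | τ ≤ p.1.ofLp ⬝ᵥ (E ω *ᵥ p.2.ofLp)} := by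
    intro ω hω
    by_contra hc
    simp only [Set.mem_iUnion, not_exists, Set.mem_ofPred_eq, not_le] at hc
    refine absurd (opNorm_le_of_nets hPs hPi hQs hQi (fun c h => (hs1 c h).2) hs3
      (fun c h => (ht1 c h).2) ht3 hτ (E := E ω) fun u hu v hv => ?_) (not_le.2 hω)
    exact (hc (u, v) (Finset.mem_product.2 ⟨hu, hv⟩)).le
  calc μ {ω | 4 * τ < ‖P * E ω * Q‖}
      ≤ ∑ p ∈ s ×ˢ t, μ {ω | τ ≤ p.1.ofLp ⬝ᵥ (E ω *ᵥ p.2.ofLp)} :=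
        (measure_mono hsubset).trans (measure_biUnion_finset_le _ _)
    _ ≤ ∑ p ∈ s ×ˢ t, ENNReal.ofReal (Real.exp (-τ ^ 2 / (2 * c))) := by
        refine Finset.sum_le_sum fun p hp => ?_
        obtain ⟨h1, h2⟩ := Finset.mem_product.1 hp
        rw [← ofReal_measureReal]
        exact ENNReal.ofReal_le_ofReal
          (measure_bilin_ge_le hind hsub (hs1 _ h1).1 (ht1 _ h2).1 hτ)
    _ ≤ ENNReal.ofReal (5 ^ (P.rank + Q.rank) * Real.exp (-τ ^ 2 / (2 * c))) := by
        rw [Finset.sum_const, nsmul_eq_mul, ← ENNReal.ofReal_natCast,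
          ← ENNReal.ofReal_mul (Nat.cast_nonneg _), Finset.card_product]
        refine ENNReal.ofReal_le_ofReal (mul_le_mul_of_nonneg_right ?_ (Real.exp_pos _).le)
        rw [pow_add]
        exact_mod_cast Nat.mul_le_mul hs2 ht2

lemma measurable_opNorm {𝒴 : Type*} [MeasurableSpace 𝒴] {f : 𝒴 → Matrix (Fin N) (Fin T) ℝ}
    (hf : ∀ i j, Measurable fun y => f y i j) : Measurable fun y => ‖f y‖ := by
  have hc : Continuous fun A : Fin N → Fin T → ℝ => ‖Matrix.of A‖ :=
    continuous_norm.comp (LinearMap.continuous_of_finiteDimensional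
      (Matrix.ofLinearEquiv ℝ : (Fin N → Fin T → ℝ) ≃ₗ[ℝ] Matrix (Fin N) (Fin T) ℝ).toLinearMap)
  exact hc.measurable.comp (measurable_pi_iff.2 fun i => measurable_pi_iff.2 fun j => hf i j)

lemma measurable_mul_apply {𝒴 ι κ l : Type*} [MeasurableSpace 𝒴] [Fintype κ]
    {f : 𝒴 → Matrix ι κ ℝ} {g : 𝒴 → Matrix κ l ℝ} (hf : ∀ i j, Measurable fun y => f y i j)
    (hg : ∀ i j, Measurable fun y => g y i j) (i : ι) (j : l) :
    Measurable fun y => (f y * g y) i j := by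
  simp only [Matrix.mul_apply]
  exact Finset.measurable_sum _ fun k _ => (hf i k).mul (hg k j)

/-- Tail bound for the operator norm of the noise, compressed by random projections that are
independent of the noise: condition on the projections. -/
lemma measure_opNorm_indep_proj_gt_le [IsProbabilityMeasure μ] {𝒴 : Type*} [MeasurableSpace 𝒴]
    {E : Ω → Matrix (Fin N) (Fin T) ℝ} {Y : Ω → 𝒴} {c : NNReal}
    (hE : ∀ i t, Measurable fun ω => E ω i t) (hY : Measurable Y)
    (hind : iIndepFun (fun (p : Fin N × Fin T) ω => E ω p.1 p.2) μ)
    (hindY : IndepFun (fun ω (p : Fin N × Fin T) => E ω p.1 p.2) Y μ)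
    (hsub : ∀ i t, HasSubgaussianMGF (fun ω => E ω i t) c μ)
    {P : 𝒴 → Matrix (Fin N) (Fin N) ℝ} {Q : 𝒴 → Matrix (Fin T) (Fin T) ℝ}
    (hPm : ∀ i j, Measurable fun y => P y i j) (hQm : ∀ i j, Measurable fun y => Q y i j)
    (hP : ∀ y, (P y)ᵀ = P y ∧ P y * P y = P y) (hQ : ∀ y, (Q y)ᵀ = Q y ∧ Q y * Q y = Q y)
    {a b : ℕ} (ha : ∀ y, (P y).rank ≤ a) (hb : ∀ y, (Q y).rank ≤ b) {τ : ℝ} (hτ : 0 ≤ τ) :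
    μ {ω | 4 * τ < ‖P (Y ω) * E ω * Q (Y ω)‖}
      ≤ ENNReal.ofReal (5 ^ (a + b) * Real.exp (-τ ^ 2 / (2 * c))) := by
  set F : Ω → (Fin N × Fin T → ℝ) := fun ω p => E ω p.1 p.2 with hF
  have hFm : Measurable F := measurable_pi_iff.2 fun p => hE p.1 p.2
  set B : Set ((Fin N × Fin T → ℝ) × 𝒴) :=
    {q | 4 * τ < ‖P q.2 * (Matrix.of fun i t => q.1 (i, t)) * Q q.2‖} with hB
  have hBm : MeasurableSet B := by
    refine measurableSet_lt measurable_const (measurable_opNorm (measurable_mul_apply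
      (measurable_mul_apply (fun i j => (hPm i j).comp measurable_snd) fun i j => ?_)
      fun i j => (hQm i j).comp measurable_snd))
    exact (measurable_pi_apply (i, j)).comp measurable_fst
  have h1 : {ω | 4 * τ < ‖P (Y ω) * E ω * Q (Y ω)‖} = (fun ω => (F ω, Y ω)) ⁻¹' B := rfl
  rw [h1, ← Measure.map_apply (hFm.prodMk hY) hBm,
    (indepFun_iff_map_prod_eq_prod_map_map hFm.aemeasurable hY.aemeasurable).1 hindY]
  have : IsProbabilityMeasure (μ.map F) := Measure.isProbabilityMeasure_map hFm.aemeasurable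
  have : IsProbabilityMeasure (μ.map Y) := Measure.isProbabilityMeasure_map hY.aemeasurable
  rw [Measure.prod_apply_symm hBm]
  have hle : ∀ y, (μ.map F) ((fun x => (x, y)) ⁻¹' B)
      ≤ ENNReal.ofReal (5 ^ (a + b) * Real.exp (-τ ^ 2 / (2 * c))) := by
    intro y
    rw [Measure.map_apply hFm (hBm.preimage measurable_prodMk_right)]
    refine (measure_opNorm_proj_gt_le hind hsub (hP y).1 (hP y).2 (hQ y).1 (hQ y).2 hτ).trans ?_
    refine ENNReal.ofReal_le_ofReal (mul_le_mul_of_nonneg_right ?_ (Real.exp_pos _).le)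
    exact pow_le_pow_right₀ (by norm_num) (add_le_add (ha y) (hb y))
  refine (lintegral_mono hle).trans ?_
  simp

end Noise

/-! ### Projections and the deterministic error bound -/

section Projection

variable {m n : Type*} [Fintype m] [Fintype n] [DecidableEq n]

/-- `projMatrix Φ` is symmetric and idempotent, even for a singular Gram matrix, where it is `0`. -/
lemma projMatrix_proj (Φ : Matrix m n ℝ) :
    (projMatrix Φ)ᵀ = projMatrix Φ ∧ projMatrix Φ * projMatrix Φ = projMatrix Φ := by
  constructor
  · simp [projMatrix, Matrix.transpose_nonsing_inv, Matrix.mul_assoc]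
  · unfold projMatrix
    by_cases h : IsUnit (Φᵀ * Φ).det
    · calc Φ * (Φᵀ * Φ)⁻¹ * Φᵀ * (Φ * (Φᵀ * Φ)⁻¹ * Φᵀ)
          = Φ * (Φᵀ * Φ)⁻¹ * ((Φᵀ * Φ) * (Φᵀ * Φ)⁻¹) * Φᵀ := by simp only [Matrix.mul_assoc]
        _ = _ := by rw [Matrix.mul_nonsing_inv _ h, Matrix.mul_one]
    · simp [Matrix.nonsing_inv_apply_not_isUnit _ h]

lemma rank_projMatrix_le (Φ : Matrix m n ℝ) : (projMatrix Φ).rank ≤ Fintype.card n := by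
  unfold projMatrix
  rw [Matrix.mul_assoc]
  exact (Matrix.rank_mul_le_left _ _).trans (Matrix.rank_le_card_width _)

lemma frobNorm_projMatrix_sq_le (Φ : Matrix m n ℝ) :
    frobNorm (projMatrix Φ) ^ 2 ≤ Fintype.card n := by
  rw [frobNorm_sq_eq_trace, (projMatrix_proj Φ).1, (projMatrix_proj Φ).2, projMatrix,
    Matrix.trace_mul_comm, ← Matrix.mul_assoc]
  by_cases h : IsUnit (Φᵀ * Φ).det
  · rw [Matrix.mul_nonsing_inv _ h, Matrix.trace_one]
  · simp [Matrix.nonsing_inv_apply_not_isUnit _ h]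

lemma one_sub_projMatrix_mul [DecidableEq m] {Φ : Matrix m n ℝ} (h : IsUnit (Φᵀ * Φ).det) :
    (1 - projMatrix Φ) * Φ = 0 := by
  rw [Matrix.sub_mul, Matrix.one_mul, projMatrix, Matrix.mul_assoc, Matrix.mul_assoc,
    Matrix.nonsing_inv_mul _ h, Matrix.mul_one, sub_self]

lemma measurable_projMatrix {𝒴 : Type*} [MeasurableSpace 𝒴] {Φ : 𝒴 → Matrix m n ℝ}
    (hΦ : ∀ i j, Measurable fun y => Φ y i j) (i j : m) :
    Measurable fun y => projMatrix (Φ y) i j := by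
  have hdet : ∀ {f : 𝒴 → Matrix n n ℝ}, (∀ i j, Measurable fun y => f y i j) →
      Measurable fun y => (f y).det := by
    intro f hf
    simp only [Matrix.det_apply]
    exact Finset.measurable_sum _ fun σ _ =>
      (Finset.measurable_prod _ fun k _ => hf (σ k) k).const_smul _
  have hgram : ∀ i j, Measurable fun y => ((Φ y)ᵀ * Φ y) i j :=
    measurable_mul_apply (fun i j => hΦ j i) hΦ
  refine measurable_mul_apply (measurable_mul_apply hΦ fun k l => ?_) (fun i j => hΦ j i) i j
  simp only [Matrix.inv_def, Ring.inverse_eq_inv', Matrix.smul_apply, smul_eq_mul,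
    Matrix.adjugate_apply]
  refine (hdet hgram).inv.mul (hdet fun a b => ?_)
  simp only [Matrix.updateRow_apply]
  split_ifs
  · exact measurable_const
  · exact hgram a b

/-- A Gram matrix with positive singular values is invertible, and then there are at least as many
rows as columns. -/
lemma gram_of_spectrumBetween {Φ : Matrix m n ℝ} {a c C : ℝ} (hc : 0 < c)
    (h : Model.SpectrumBetween (a • (Φᵀ * Φ)) c C) :
    IsUnit (Φᵀ * Φ).det ∧ Fintype.card n ≤ Fintype.card m := by
  have hinj : Function.Injective (Matrix.toEuclideanLin (a • (Φᵀ * Φ))) := by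
    rw [LinearMap.injective_iff_forall_lt_finrank_singularValues_pos]
    intro k hk
    exact hc.trans (h k (by simpa using hk)).1
  have hker : ∀ x : n → ℝ, (Φᵀ * Φ) *ᵥ x = 0 → x = 0 := by
    intro x hx
    have : Matrix.toEuclideanLin (a • (Φᵀ * Φ)) (WithLp.toLp 2 x) = 0 := by
      rw [Matrix.toLpLin_apply, Matrix.smul_mulVec, hx]
      simp
    have h0 := (injective_iff_map_eq_zero _).1 hinj _ this
    simpa using congrArg WithLp.ofLp h0
  constructor
  · rw [← Matrix.isUnit_iff_isUnit_det, ← Matrix.mulVec_injective_iff_isUnit,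
      ← Matrix.coe_mulVecLin, ← LinearMap.ker_eq_bot, LinearMap.ker_eq_bot']
    exact hker
  · have : Function.Injective Φ.mulVecLin := by
      rw [← LinearMap.ker_eq_bot, LinearMap.ker_eq_bot']
      intro x hx
      apply hker
      rw [← Matrix.mulVec_mulVec, ← Matrix.mulVecLin_apply Φ, hx, Matrix.mulVec_zero]
    simpa using LinearMap.finrank_le_finrank_of_injective this

end Projection

section Deterministic

variable {N T : ℕ}

lemma rank_add_le (A B : Matrix (Fin N) (Fin T) ℝ) : (A + B).rank ≤ A.rank + B.rank := by
  refine (Submodule.finrank_mono ?_).trans (Submodule.finrank_add_le_finrank_add_finrank _ _)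
  rintro _ ⟨x, rfl⟩
  rw [Matrix.mulVecLin_add]
  exact Submodule.add_mem_sup ⟨x, rfl⟩ ⟨x, rfl⟩

lemma frobNorm_proj_mul_le {n : Type*} [Fintype n] [DecidableEq n] {P : Matrix (Fin N) (Fin N) ℝ}
    (hP : Pᵀ = P ∧ P * P = P) (A : Matrix (Fin N) n ℝ) : frobNorm (P * A) ≤ frobNorm A := by
  have h1 := frobNorm_mul_le_opNorm_mul P A
  have h2 := opNorm_le_one_of_proj hP.1 hP.2
  nlinarith [frobNorm_nonneg A]

lemma frobNorm_mul_proj_le {m : Type*} [Fintype m] [DecidableEq m] {Q : Matrix (Fin T) (Fin T) ℝ}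
    (hQ : Qᵀ = Q ∧ Q * Q = Q) (A : Matrix m (Fin T) ℝ) : frobNorm (A * Q) ≤ frobNorm A := by
  have h1 := frobNorm_mul_le_mul_opNorm A Q
  have h2 := opNorm_le_one_of_proj hQ.1 hQ.2
  nlinarith [frobNorm_nonneg A]

lemma opNorm_proj_mul_le {P : Matrix (Fin N) (Fin N) ℝ} (hP : Pᵀ = P ∧ P * P = P)
    (A : Matrix (Fin N) (Fin T) ℝ) : ‖P * A‖ ≤ ‖A‖ := by
  have h1 := Matrix.l2_opNorm_mul P A
  have h2 := opNorm_le_one_of_proj hP.1 hP.2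
  nlinarith [norm_nonneg A]

lemma opNorm_mul_proj_le {Q : Matrix (Fin T) (Fin T) ℝ} (hQ : Qᵀ = Q ∧ Q * Q = Q)
    (A : Matrix (Fin N) (Fin T) ℝ) : ‖A * Q‖ ≤ ‖A‖ := by
  have h1 := Matrix.l2_opNorm_mul A Q
  have h2 := opNorm_le_one_of_proj hQ.1 hQ.2
  nlinarith [norm_nonneg A]

lemma frobNorm_eq_zero_of_card {K : ℕ} (A : Matrix (Fin N) (Fin K) ℝ) (h : (K : ℝ) * N = 0) :
    frobNorm A = 0 := by
  rcases mul_eq_zero.1 h with h | h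
  · have : K = 0 := by exact_mod_cast h
    subst this; simp [frobNorm]
  · have : N = 0 := by exact_mod_cast h
    subst this; simp [frobNorm]

/-- The part of a factor matrix `F` that the sieve space of `Φ` misses is small, and remains so
after multiplication with loadings `H` of bounded size. -/
lemma frobNorm_one_sub_projMatrix_mul_le {K : ℕ} {n : Type*} [Fintype n] [DecidableEq n]
    {Φ : Matrix (Fin N) n ℝ} (hΦ : IsUnit (Φᵀ * Φ).det) {F : Matrix (Fin N) (Fin K) ℝ}
    {H : Matrix (Fin T) (Fin K) ℝ} {b : Fin K → n → ℝ} {δ A : ℝ} (hδ : 0 ≤ δ)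
    (hF : ∀ i k, |F i k - b k ⬝ᵥ Φ i| ≤ δ) (hH : frobNorm H ≤ A * √((K : ℝ) * T)) :
    frobNorm ((1 - projMatrix Φ) * (F * Hᵀ)) ≤ A * δ * (√((N : ℝ) * T) * K) := by
  set R : Matrix (Fin N) (Fin K) ℝ := F - Φ * (Matrix.of b)ᵀ with hR
  have e1 : (1 - projMatrix Φ) * (F * Hᵀ) = (1 - projMatrix Φ) * (R * Hᵀ) := by
    rw [hR, Matrix.sub_mul F, Matrix.mul_sub (1 - projMatrix Φ), Matrix.mul_assoc Φ,
      ← Matrix.mul_assoc _ Φ, one_sub_projMatrix_mul hΦ, Matrix.zero_mul, sub_zero]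
  have e2 : frobNorm R ≤ δ * √((N : ℝ) * K) := by
    have : frobNorm R ^ 2 ≤ δ ^ 2 * ((N : ℝ) * K) := by
      rw [frobNorm_sq]
      calc ∑ i, ∑ k, R i k ^ 2 ≤ ∑ _i : Fin N, ∑ _k : Fin K, δ ^ 2 := by
            refine Finset.sum_le_sum fun i _ => Finset.sum_le_sum fun k _ => ?_
            rw [← sq_abs]
            refine pow_le_pow_left₀ (abs_nonneg _) ?_ 2
            have := hF i k
            rwa [dotProduct_comm] at this
        _ = δ ^ 2 * ((N : ℝ) * K) := by simp; ring
    apply le_of_sq_le_sq _ (by positivity)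
    rwa [mul_pow, Real.sq_sqrt (by positivity)]
  have hp := one_sub_proj (projMatrix_proj Φ).1 (projMatrix_proj Φ).2
  rw [e1]
  calc frobNorm ((1 - projMatrix Φ) * (R * Hᵀ)) ≤ frobNorm (R * Hᵀ) := frobNorm_proj_mul_le hp _
    _ ≤ frobNorm R * frobNorm H := by
        rw [← frobNorm_transpose H]; exact frobNorm_mul_le _ _
    _ ≤ (δ * √((N : ℝ) * K)) * (A * √((K : ℝ) * T)) :=
        mul_le_mul e2 hH (frobNorm_nonneg _) (by positivity)
    _ = A * δ * (√((N : ℝ) * T) * K) := by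
        rw [Real.sqrt_mul (Nat.cast_nonneg _), Real.sqrt_mul (Nat.cast_nonneg _),
          Real.sqrt_mul (Nat.cast_nonneg _)]
        have : √(K : ℝ) * √(K : ℝ) = K := Real.mul_self_sqrt (Nat.cast_nonneg _)
        calc _ = A * δ * (√(N : ℝ) * √(T : ℝ)) * (√(K : ℝ) * √(K : ℝ)) := by ring
          _ = _ := by rw [this]; ring

/-- One regularized block of the estimator: signal `L` of rank at most `r`, approximation error `R`
and noise `Δ`. -/
lemma frobNorm_block_le {L R Δ Ahat : Matrix (Fin N) (Fin T) ℝ} {c s x : ℝ} {r : ℕ}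
    (h : IsNuclearMinimizer (L + R + Δ) (c * s) Ahat) (hc : 1 ≤ c) (hs : 0 ≤ s)
    (hΔ : ‖Δ‖ ≤ s / 4) (hR : frobNorm R ≤ s / 4) (hr : L.rank ≤ r) (hx : frobNorm L ≤ x) :
    frobNorm (Ahat - (L + R)) ≤ 3 * c * (√(r : ℝ) * min s x) + frobNorm R := by
  have hcs : s ≤ c * s := le_mul_of_one_le_left hs hc
  have h2 : 2 * ‖R + Δ‖ ≤ c * s := by
    have := norm_add_le R Δ
    have := opNorm_le_frobNorm R
    linarith
  rw [add_assoc] at h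
  obtain ⟨b1, b2⟩ := h.frobNorm_sub_le h2
  have hx0 : 0 ≤ x := (frobNorm_nonneg _).trans hx
  have e : Ahat - (L + R) = (Ahat - L) - R := by abel
  have key : frobNorm (Ahat - L) ≤ 3 * c * (√(r : ℝ) * min s x) := by
    have hr' : √(L.rank : ℝ) ≤ √(r : ℝ) := Real.sqrt_le_sqrt (by exact_mod_cast hr)
    rcases Nat.eq_zero_or_pos r with h0 | h0
    · subst h0
      have : L.rank = 0 := by omega
      rw [this] at b1
      simpa using b1
    · have h1 : 1 ≤ √(r : ℝ) := Real.one_le_sqrt.2 (by exact_mod_cast h0)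
      rcases min_choice s x with hm | hm <;> rw [hm]
      · calc frobNorm (Ahat - L) ≤ 3 * (c * s) * √(L.rank : ℝ) := b1
          _ ≤ 3 * (c * s) * √(r : ℝ) := by gcongr
          _ = _ := by ring
      · calc frobNorm (Ahat - L) ≤ 3 * frobNorm L := b2
          _ ≤ 3 * (1 * (1 * x)) := by linarith
          _ ≤ 3 * (c * (√(r : ℝ) * x)) := by gcongr
          _ = _ := by ring
  rw [e]
  exact (frobNorm_sub_le _ _).trans (by linarith)

/-- The deterministic error bound for the estimator, on the event that the noise is dominated by the
penalties. The numbers `ρ` bound the sieve approximation errors. -/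
lemma frobNorm_estimator_sub_le {P : Matrix (Fin N) (Fin N) ℝ} {Q : Matrix (Fin T) (Fin T) ℝ}
    {M₁ M₂ M₃ M₄ E A₂ A₃ A₄ : Matrix (Fin N) (Fin T) ℝ} (hP : Pᵀ = P ∧ P * P = P)
    (hQ : Qᵀ = Q ∧ Q * Q = Q) {c₂ c₃ c₄ s₂ s₃ s₄ η ρG₁ ρG₂ ρQ₁ ρQ₂ : ℝ} {K₂ K₃ K₄ : ℕ}
    (hc₂ : 1 ≤ c₂) (hc₃ : 1 ≤ c₃) (hc₄ : 1 ≤ c₄) (hs₂ : 0 ≤ s₂) (hs₃ : 0 ≤ s₃) (hs₄ : 0 ≤ s₄)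
    (hM₂ : M₂.rank ≤ K₂) (hM₃ : M₃.rank ≤ K₃) (hM₄ : M₄.rank ≤ K₄)
    (hG₁ : frobNorm ((1 - P) * M₁) ≤ ρG₁) (hG₂ : frobNorm ((1 - P) * M₂) ≤ ρG₂)
    (hQ₁ : frobNorm (M₁ * (1 - Q)) ≤ ρQ₁) (hQ₂ : frobNorm (M₃ * (1 - Q)) ≤ ρQ₂)
    (hρ₂ : ρQ₁ + ρQ₂ ≤ s₂ / 4) (hρ₃ : ρG₁ + ρG₂ ≤ s₃ / 4) (hρ₄ : ρQ₁ + ρG₂ + ρQ₂ ≤ s₄ / 4)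
    (hE₁ : frobNorm (P * E * Q) ≤ η) (hE₂ : ‖P * E‖ ≤ s₂ / 4) (hE₃ : ‖E * Q‖ ≤ s₃ / 4)
    (hE₄ : ‖E‖ ≤ s₄ / 4)
    (h₂ : IsNuclearMinimizer (P * (M₁ + M₂ + M₃ + M₄ + E) * (1 - Q)) (c₂ * s₂) A₂)
    (h₃ : IsNuclearMinimizer ((1 - P) * (M₁ + M₂ + M₃ + M₄ + E) * Q) (c₃ * s₃) A₃)
    (h₄ : IsNuclearMinimizer ((1 - P) * (M₁ + M₂ + M₃ + M₄ + E) * (1 - Q)) (c₄ * s₄) A₄) :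
    frobNorm (P * (M₁ + M₂ + M₃ + M₄ + E) * Q + A₂ + A₃ + A₄ - (M₁ + M₂ + M₃ + M₄)) ≤
      η + 3 * c₂ * (√((K₂ + K₄ : ℕ) : ℝ) * min s₂ (frobNorm M₂ + frobNorm (P * M₄)))
      + 3 * c₃ * (√((K₃ + K₄ : ℕ) : ℝ) * min s₃ (frobNorm M₃ + frobNorm (M₄ * Q)))
      + 3 * c₄ * (√(K₄ : ℝ) * min s₄ (frobNorm M₄))
      + 2 * (ρG₁ + ρQ₁ + ρG₂ + ρQ₂) := by
  have hP' := one_sub_proj hP.1 hP.2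
  have hQ' := one_sub_proj hQ.1 hQ.2
  have rk : ∀ (A : Matrix (Fin N) (Fin N) ℝ) (B : Matrix (Fin N) (Fin T) ℝ)
      (C : Matrix (Fin T) (Fin T) ℝ), (A * B * C).rank ≤ B.rank := fun A B C =>
    (Matrix.rank_mul_le_left _ _).trans (Matrix.rank_mul_le_right _ _)
  have fr : ∀ {A : Matrix (Fin N) (Fin N) ℝ} (B : Matrix (Fin N) (Fin T) ℝ)
      {C : Matrix (Fin T) (Fin T) ℝ}, (Aᵀ = A ∧ A * A = A) → (Cᵀ = C ∧ C * C = C) →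
      frobNorm (A * B * C) ≤ frobNorm B := fun B _ hA hC =>
    (frobNorm_mul_proj_le hC _).trans (frobNorm_proj_mul_le hA B)
  -- The approximation errors in the three blocks.
  set R₂ := P * (M₁ + M₃) * (1 - Q) with hR₂
  set R₃ := (1 - P) * (M₁ + M₂) * Q with hR₃
  set R₄ := (1 - P) * (M₁ + M₂ + M₃) * (1 - Q) with hR₄
  have bR₂ : frobNorm R₂ ≤ ρQ₁ + ρQ₂ := by
    rw [hR₂, Matrix.mul_assoc, Matrix.add_mul]
    refine (frobNorm_proj_mul_le hP _).trans ((frobNorm_add_le _ _).trans ?_)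
    linarith
  have bR₃ : frobNorm R₃ ≤ ρG₁ + ρG₂ := by
    rw [hR₃, Matrix.mul_add]
    refine (frobNorm_mul_proj_le hQ _).trans ((frobNorm_add_le _ _).trans ?_)
    linarith
  have bR₄ : frobNorm R₄ ≤ ρQ₁ + ρG₂ + ρQ₂ := by
    have e : R₄ = (1 - P) * (M₁ * (1 - Q)) + ((1 - P) * M₂) * (1 - Q)
        + (1 - P) * (M₃ * (1 - Q)) := by
      rw [hR₄]; simp only [Matrix.mul_add, Matrix.add_mul, Matrix.mul_assoc]
    rw [e]
    have i1 := frobNorm_add_le ((1 - P) * (M₁ * (1 - Q)) + ((1 - P) * M₂) * (1 - Q))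
      ((1 - P) * (M₃ * (1 - Q)))
    have i2 := frobNorm_add_le ((1 - P) * (M₁ * (1 - Q))) (((1 - P) * M₂) * (1 - Q))
    have i3 := frobNorm_proj_mul_le hP' (M₁ * (1 - Q))
    have i4 := frobNorm_proj_mul_le hP' (M₃ * (1 - Q))
    have i5 := frobNorm_mul_proj_le hQ' ((1 - P) * M₂)
    linarith
  have bl₂ := frobNorm_block_le (L := P * (M₂ + M₄) * (1 - Q)) (R := R₂) (Δ := P * E * (1 - Q))
    (Ahat := A₂) (c := c₂) (s := s₂) (x := frobNorm M₂ + frobNorm (P * M₄)) (r := K₂ + K₄)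
    (by convert h₂ using 1; rw [hR₂]; simp only [Matrix.mul_add, Matrix.add_mul]; abel) hc₂ hs₂
    ((opNorm_mul_proj_le hQ' _).trans hE₂) (bR₂.trans hρ₂)
    ((rk _ _ _).trans ((rank_add_le _ _).trans (add_le_add hM₂ hM₄)))
    (by
      rw [Matrix.mul_add]
      refine (frobNorm_mul_proj_le hQ' _).trans ((frobNorm_add_le _ _).trans ?_)
      linarith [frobNorm_proj_mul_le hP M₂])
  have bl₃ := frobNorm_block_le (L := (1 - P) * (M₃ + M₄) * Q) (R := R₃) (Δ := (1 - P) * E * Q)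
    (Ahat := A₃) (c := c₃) (s := s₃) (x := frobNorm M₃ + frobNorm (M₄ * Q)) (r := K₃ + K₄)
    (by convert h₃ using 1; rw [hR₃]; simp only [Matrix.mul_add, Matrix.add_mul]; abel) hc₃ hs₃
    (by rw [Matrix.mul_assoc]; exact (opNorm_proj_mul_le hP' _).trans hE₃) (bR₃.trans hρ₃)
    ((rk _ _ _).trans ((rank_add_le _ _).trans (add_le_add hM₃ hM₄)))
    (by
      rw [Matrix.mul_assoc, Matrix.add_mul]
      refine (frobNorm_proj_mul_le hP' _).trans ((frobNorm_add_le _ _).trans ?_)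
      linarith [frobNorm_mul_proj_le hQ M₃])
  have bl₄ := frobNorm_block_le (L := (1 - P) * M₄ * (1 - Q)) (R := R₄)
    (Δ := (1 - P) * E * (1 - Q)) (Ahat := A₄) (c := c₄) (s := s₄) (x := frobNorm M₄) (r := K₄)
    (by convert h₄ using 1; rw [hR₄]; simp only [Matrix.mul_add, Matrix.add_mul]; abel) hc₄ hs₄
    ((opNorm_mul_proj_le hQ' _).trans ((opNorm_proj_mul_le hP' _).trans hE₄)) (bR₄.trans hρ₄)
    ((rk _ _ _).trans hM₄) (fr M₄ hP' hQ')
  have e : P * (M₁ + M₂ + M₃ + M₄ + E) * Q + A₂ + A₃ + A₄ - (M₁ + M₂ + M₃ + M₄)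
      = P * E * Q + (A₂ - (P * (M₂ + M₄) * (1 - Q) + R₂))
        + (A₃ - ((1 - P) * (M₃ + M₄) * Q + R₃)) + (A₄ - ((1 - P) * M₄ * (1 - Q) + R₄)) := by
    rw [hR₂, hR₃, hR₄]
    simp only [Matrix.mul_add, Matrix.add_mul, Matrix.sub_mul, Matrix.mul_sub, Matrix.one_mul,
      Matrix.mul_one]
    abel
  rw [e]
  have t1 := frobNorm_add_le (P * E * Q + (A₂ - (P * (M₂ + M₄) * (1 - Q) + R₂))
        + (A₃ - ((1 - P) * (M₃ + M₄) * Q + R₃))) (A₄ - ((1 - P) * M₄ * (1 - Q) + R₄))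
  have t2 := frobNorm_add_le (P * E * Q + (A₂ - (P * (M₂ + M₄) * (1 - Q) + R₂)))
        (A₃ - ((1 - P) * (M₃ + M₄) * Q + R₃))
  have t3 := frobNorm_add_le (P * E * Q) (A₂ - (P * (M₂ + M₄) * (1 - Q) + R₂))
  have p1 := (frobNorm_nonneg _).trans hG₁
  have p2 := (frobNorm_nonneg _).trans hG₂
  linarith

end Deterministic

/-! ### Probability bounds -/

section Asymptotics

variable {Ω : Type*} [MeasurableSpace Ω] {μ : Measure Ω}

/-- For all large `n`, the event `p n` fails with outer measure at most `ε`. Bounding the complement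
spares any statement about the measurability of `p n`. -/
def HoldsWithProb (μ : Measure Ω) (ε : ℝ) (p : ℕ → Ω → Prop) : Prop :=
  ∀ᶠ n in atTop, μ {ω | ¬ p n ω} ≤ ENNReal.ofReal ε

lemma HoldsWithProb.and {ε ε' : ℝ} {p q : ℕ → Ω → Prop} (hp : HoldsWithProb μ ε p)
    (hq : HoldsWithProb μ ε' q) (hε : 0 ≤ ε) (hε' : 0 ≤ ε') :
    HoldsWithProb μ (ε + ε') fun n ω => p n ω ∧ q n ω := by
  filter_upwards [hp, hq] with n h1 h2
  have : {ω | ¬ (p n ω ∧ q n ω)} ⊆ {ω | ¬ p n ω} ∪ {ω | ¬ q n ω} := by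
    intro ω hω
    by_cases h : p n ω
    · exact Or.inr fun h' => hω ⟨h, h'⟩
    · exact Or.inl h
  rw [ENNReal.ofReal_add hε hε']
  exact (measure_mono this).trans ((measure_union_le _ _).trans (add_le_add h1 h2))

lemma HoldsWithProb.mono {ε : ℝ} {p q : ℕ → Ω → Prop} (hp : HoldsWithProb μ ε p)
    (h : ∀ᶠ n in atTop, ∀ ω, p n ω → q n ω) : HoldsWithProb μ ε q := by
  filter_upwards [hp, h] with n h1 h2
  have : {ω | ¬ q n ω} ⊆ {ω | ¬ p n ω} := fun ω hω h' => hω (h2 ω h')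
  exact (measure_mono this).trans h1

lemma holdsWithProb_of_tendsto {p : ℕ → Ω → Prop}
    (h : Tendsto (fun n => μ {ω | ¬ p n ω}) atTop (𝓝 0)) {ε : ℝ} (hε : 0 < ε) :
    HoldsWithProb μ ε p :=
  (h.eventually (gt_mem_nhds (ENNReal.ofReal_pos.2 hε))).mono fun _ h => h.le

lemma holdsWithProb_of_ae {p : ℕ → Ω → Prop} (h : ∀ n, ∀ᵐ ω ∂μ, p n ω) {ε : ℝ} :
    HoldsWithProb μ ε p :=
  Eventually.of_forall fun n => (ae_iff.1 (h n)).le.trans zero_le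

/-- Markov's inequality for the Frobenius norm of a matrix with bounded second moments. -/
lemma holdsWithProb_frobNorm_le {N K : ℕ → ℕ} {W : ∀ n, Ω → Matrix (Fin (N n)) (Fin (K n)) ℝ}
    {C : ℝ} (hC : 0 < C) (h : ∀ n i k, Model.SecondMomentLE μ (fun ω => W n ω i k) C) {ε : ℝ}
    (hε : 0 < ε) :
    ∃ A : ℝ, 0 < A ∧
      HoldsWithProb μ ε fun n ω => frobNorm (W n ω) ≤ A * √((K n : ℝ) * N n) := by
  refine ⟨√(C / ε), by positivity, Eventually.of_forall fun n => ?_⟩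
  rcases eq_or_ne ((K n : ℝ) * N n) 0 with h0 | h0
  · simp [h0, frobNorm_eq_zero_of_card _ h0]
  have hpos : 0 < (K n : ℝ) * N n := lt_of_le_of_ne (by positivity) h0.symm
  have hint : Integrable (fun ω => frobNorm (W n ω) ^ 2) μ := by
    simp only [frobNorm_sq]
    exact integrable_finsetSum _ fun i _ => integrable_finsetSum _ fun k _ => (h n i k).1
  have hle : ∫ ω, frobNorm (W n ω) ^ 2 ∂μ ≤ C * ((K n : ℝ) * N n) := by
    simp only [frobNorm_sq]
    rw [integral_finsetSum _ fun i _ => integrable_finsetSum _ fun k _ => (h n i k).1]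
    calc ∑ i, ∫ ω, ∑ k, W n ω i k ^ 2 ∂μ ≤ ∑ _i : Fin (N n), ∑ _k : Fin (K n), C := by
          refine Finset.sum_le_sum fun i _ => ?_
          rw [integral_finsetSum _ fun k _ => (h n i k).1]
          exact Finset.sum_le_sum fun k _ => (h n i k).2
      _ = _ := by simp; ring
  have hmarkov := mul_meas_ge_le_lintegral₀ (μ := μ)
    (f := fun ω => ENNReal.ofReal (frobNorm (W n ω) ^ 2)) hint.aemeasurable.ennreal_ofReal
    (ENNReal.ofReal (C / ε * ((K n : ℝ) * N n)))
  rw [← ofReal_integral_eq_lintegral_ofReal hint (ae_of_all _ fun ω => sq_nonneg _)] at hmarkov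
  have hsub : {ω | ¬ frobNorm (W n ω) ≤ √(C / ε) * √((K n : ℝ) * N n)} ⊆
      {ω | ENNReal.ofReal (C / ε * ((K n : ℝ) * N n)) ≤ ENNReal.ofReal (frobNorm (W n ω) ^ 2)} := by
    intro ω hω
    refine ENNReal.ofReal_le_ofReal ?_
    rw [Set.mem_ofPred_eq, not_le, ← Real.sqrt_mul (by positivity)] at hω
    have := pow_le_pow_left₀ (Real.sqrt_nonneg _) hω.le 2
    rwa [Real.sq_sqrt (by positivity)] at this
  refine (measure_mono hsub).trans ?_
  have hx : 0 < C / ε * ((K n : ℝ) * N n) := by positivity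
  refine (ENNReal.mul_le_mul_iff_right (ENNReal.ofReal_pos.2 hx).ne' ENNReal.ofReal_ne_top).1
    (hmarkov.trans ?_)
  rw [← ENNReal.ofReal_mul hx.le]
  refine ENNReal.ofReal_le_ofReal (hle.trans_eq ?_)
  field_simp

/-- The sieve approximation error of a factor structure, in Frobenius norm. -/
lemma holdsWithProb_sieve_le {d : ℕ} {N T J K : ℕ → ℕ} {f : ∀ n, Fin (K n) → (Fin d → ℝ) → ℝ}
    {basis : ∀ n, (Fin d → ℝ) → Fin d × Fin (J n) → ℝ} {D : ℕ → Set (Fin d → ℝ)} {γ : ℝ}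
    (h : Model.SieveApprox J K f basis D γ) {x : ∀ n, Ω → Fin (N n) → Fin d → ℝ}
    (hx : ∀ n, ∀ᵐ ω ∂μ, ∀ i, x n ω i ∈ D n) {H : ∀ n, Ω → Matrix (Fin (T n)) (Fin (K n)) ℝ} {C : ℝ}
    (hC : 0 < C) (hH : ∀ n t k, Model.SecondMomentLE μ (fun ω => H n ω t k) C)
    (hgram : ∀ ε : ℝ, 0 < ε → HoldsWithProb μ ε fun n ω =>
      IsUnit ((Matrix.of fun i => basis n (x n ω i))ᵀ *
        (Matrix.of fun i => basis n (x n ω i))).det) {ε : ℝ} (hε : 0 < ε) :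
    ∃ B : ℝ, 0 ≤ B ∧ HoldsWithProb μ ε fun n ω =>
      frobNorm ((1 - projMatrix (Matrix.of fun i => basis n (x n ω i))) *
        ((Matrix.of fun i k => f n k (x n ω i)) * (H n ω)ᵀ))
      ≤ B * (√((N n : ℝ) * T n) * (K n / (J n : ℝ) ^ γ)) := by
  obtain ⟨A, hA, hA'⟩ := holdsWithProb_frobNorm_le hC hH (half_pos hε)
  obtain ⟨b, C', hb⟩ := h
  refine ⟨A * |C'|, by positivity, ?_⟩
  have hall := (hA'.and ((hgram (ε / 2) (half_pos hε)).and (holdsWithProb_of_ae hx (ε := 0))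
    (half_pos hε).le le_rfl) (half_pos hε).le (by linarith))
  have e : ε / 2 + (ε / 2 + 0) = ε := by ring
  rw [e] at hall
  refine hall.mono ?_
  filter_upwards [hb] with n hn ω hω
  obtain ⟨h1, h2, h3⟩ := hω
  have hJ : (0 : ℝ) ≤ (J n : ℝ) ^ (-γ) := Real.rpow_nonneg (Nat.cast_nonneg _) _
  refine (frobNorm_one_sub_projMatrix_mul_le h2 (b := b n) (δ := |C'| * (J n : ℝ) ^ (-γ)) (A := A)
    (by positivity) (fun i k => ?_) h1).trans_eq ?_
  · exact (hn k _ (h3 i)).trans (mul_le_mul_of_nonneg_right (le_abs_self _) hJ)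
  · rw [Real.rpow_neg (Nat.cast_nonneg _)]
    ring

lemma five_pow_mul_exp_le {k : ℕ} {q m B x : ℝ} (hk : (k : ℝ) ≤ q * m)
    (hx : (2 * q + B) * m ≤ x) : 5 ^ k * Real.exp (-x) ≤ Real.exp (-(B * m)) := by
  have h5 : (5 : ℝ) ≤ Real.exp 2 := by
    have h1 := Real.exp_one_gt_d9
    have h2 : Real.exp 2 = Real.exp 1 * Real.exp 1 := by rw [← Real.exp_add]; norm_num
    nlinarith
  calc (5 : ℝ) ^ k * Real.exp (-x) ≤ Real.exp 2 ^ k * Real.exp (-x) := by gcongr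
    _ = Real.exp (k * 2 + -x) := by rw [← Real.exp_nat_mul, Real.exp_add]
    _ ≤ _ := Real.exp_le_exp.2 (by linarith)

/-- A rate `B * √(a b) * u / v` is eventually a small multiple of `√a`, once `w * u / v` vanishes for
some `w ≥ √b`. -/
lemma eventually_mul_sqrt_le {a b u : ℕ → ℕ} {w v : ℕ → ℝ} (hw : ∀ n, √(b n : ℝ) ≤ w n)
    (hv : ∀ n, 0 ≤ v n) (h : Tendsto (fun n => w n * u n / v n) atTop (𝓝 0)) {B η : ℝ} (hB : 0 ≤ B)
    (hη : 0 < η) :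
    ∀ᶠ n in atTop, B * (√((a n : ℝ) * b n) * (u n / v n)) ≤ η * √(a n : ℝ) := by
  have h2 : Tendsto (fun n => B * (w n * u n / v n)) atTop (𝓝 0) := by
    simpa using h.const_mul B
  filter_upwards [h2.eventually (gt_mem_nhds hη)] with n hn
  have hv' := hv n
  have hw' := hw n
  calc B * (√((a n : ℝ) * b n) * (u n / v n))
      = B * (√(b n : ℝ) * u n / v n) * √(a n : ℝ) := by
        rw [Real.sqrt_mul (Nat.cast_nonneg _)]; ring
    _ ≤ B * (w n * u n / v n) * √(a n : ℝ) := by gcongr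
    _ ≤ η * √(a n : ℝ) := by gcongr

end Asymptotics

namespace Model

variable {Ω : Type*} [MeasurableSpace Ω] {d₁ d₂ : ℕ} {S : Model Ω d₁ d₂} {μ : Measure Ω}

lemma NoiseAssumption.hasSubgaussianMGF {C₁ C₂ : ℝ} (hC₁ : 0 < C₁) (hC₂ : 0 < C₂)
    (h : S.NoiseAssumption μ C₁ C₂) (n : ℕ) (i : Fin (S.N n)) (t : Fin (S.T n)) :
    HasSubgaussianMGF (fun ω => S.E n ω i t) (2 * C₁ * C₂).toNNReal μ := by
  obtain ⟨σ, hσ, hs⟩ := h.subgaussian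
  refine ⟨fun s => ((hs n i t).2 s).1, fun s => ((hs n i t).2 s).2.trans ?_⟩
  rw [Real.coe_toNNReal _ (by positivity)]
  refine Real.exp_le_exp.2 ?_
  have : C₂ * s ^ 2 * σ ^ 2 ≤ C₂ * s ^ 2 * C₁ := by gcongr
  linarith

/-- Tail bound for the noise compressed by projections that are functions of the covariates. -/
lemma NoiseAssumption.measure_gt_le [IsProbabilityMeasure μ] {C₁ C₂ : ℝ} (hC₁ : 0 < C₁)
    (hC₂ : 0 < C₂) (h : S.NoiseAssumption μ C₁ C₂) (n : ℕ)
    {P : (Fin (S.N n) → Fin d₁ → ℝ) → Matrix (Fin (S.N n)) (Fin (S.N n)) ℝ}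
    {Q : (Fin (S.T n) → Fin d₂ → ℝ) → Matrix (Fin (S.T n)) (Fin (S.T n)) ℝ}
    (hPm : ∀ i j, Measurable fun y => P y i j) (hQm : ∀ i j, Measurable fun y => Q y i j)
    (hP : ∀ y, (P y)ᵀ = P y ∧ P y * P y = P y) (hQ : ∀ y, (Q y)ᵀ = Q y ∧ Q y * Q y = Q y)
    {a b : ℕ} (ha : ∀ y, (P y).rank ≤ a) (hb : ∀ y, (Q y).rank ≤ b) {q m B x : ℝ} (hx : 0 ≤ x)
    (hab : ((a + b : ℕ) : ℝ) ≤ q * m)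
    (hxB : (2 * q + B) * m ≤ (x / 4) ^ 2 / (2 * (2 * C₁ * C₂))) :
    μ {ω | ¬ ‖P (S.X n ω) * S.E n ω * Q (S.Z n ω)‖ ≤ x} ≤ ENNReal.ofReal (Real.exp (-(B * m))) := by
  have h1 := measure_opNorm_indep_proj_gt_le (S.measurable_E n)
    ((S.measurable_X n).prodMk (S.measurable_Z n)) (h.indep n) (h.indep_covariates n)
    (fun i t => h.hasSubgaussianMGF hC₁ hC₂ n i t) (P := fun y => P y.1) (Q := fun y => Q y.2)
    (fun i j => (hPm i j).comp measurable_fst) (fun i j => (hQm i j).comp measurable_snd)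
    (fun y => hP y.1) (fun y => hQ y.2) (fun y => ha y.1) (fun y => hb y.2) (τ := x / 4)
    (by positivity)
  rw [Real.coe_toNNReal _ (by positivity), neg_div] at h1
  have h2 : (4 : ℝ) * (x / 4) = x := by ring
  simp only [h2] at h1
  simp only [not_le]
  exact h1.trans (ENNReal.ofReal_le_ofReal (five_pow_mul_exp_le hab hxB))

lemma ae_mem_rowSupport [IsProbabilityMeasure μ] (n : ℕ) :
    ∀ᵐ ω ∂μ, ∀ i, S.X n ω i ∈ S.rowSupport μ n := by
  rw [ae_all_iff]
  intro i
  have hm : Measurable fun ω => S.X n ω i := (measurable_pi_apply i).comp (S.measurable_X n)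
  filter_upwards [ae_of_ae_map hm.aemeasurable
    (Measure.support_mem_ae (μ := μ.map fun ω => S.X n ω i))] with ω hω
  exact Set.mem_iUnion.2 ⟨i, hω⟩

lemma ae_mem_colSupport [IsProbabilityMeasure μ] (n : ℕ) :
    ∀ᵐ ω ∂μ, ∀ t, S.Z n ω t ∈ S.colSupport μ n := by
  rw [ae_all_iff]
  intro t
  have hm : Measurable fun ω => S.Z n ω t := (measurable_pi_apply t).comp (S.measurable_Z n)
  filter_upwards [ae_of_ae_map hm.aemeasurable
    (Measure.support_mem_ae (μ := μ.map fun ω => S.Z n ω t))] with ω hω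
  exact Set.mem_iUnion.2 ⟨t, hω⟩

lemma BasisAssumption.isUnit_gram (h : S.BasisAssumption μ) {ε : ℝ} (hε : 0 < ε) :
    HoldsWithProb μ ε fun n ω => (IsUnit ((S.Phi n ω)ᵀ * S.Phi n ω).det ∧ d₁ * S.J n ≤ S.N n) ∧
      IsUnit ((S.Psi n ω)ᵀ * S.Psi n ω).det ∧ d₂ * S.J n ≤ S.T n := by
  obtain ⟨c, C, hc, -, hlim⟩ := h.gram
  refine (holdsWithProb_of_tendsto hlim hε).mono (Eventually.of_forall fun n ω hω => ?_)
  have h1 := gram_of_spectrumBetween hc hω.1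
  have h2 := gram_of_spectrumBetween hc hω.2
  simpa using And.intro h1 h2

lemma BasisAssumption.eventually_J_le [IsProbabilityMeasure μ] (hd₁ : 1 ≤ d₁) (hd₂ : 1 ≤ d₂)
    (h : S.BasisAssumption μ) : ∀ᶠ n in atTop, S.J n ≤ S.N n ∧ S.J n ≤ S.T n := by
  filter_upwards [h.isUnit_gram (ε := 1 / 2) (by norm_num)] with n hn
  by_contra hc
  have : {ω | ¬ ((IsUnit ((S.Phi n ω)ᵀ * S.Phi n ω).det ∧ d₁ * S.J n ≤ S.N n) ∧
      IsUnit ((S.Psi n ω)ᵀ * S.Psi n ω).det ∧ d₂ * S.J n ≤ S.T n)} = Set.univ := by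
    refine Set.eq_univ_of_forall fun ω hω => hc ?_
    exact ⟨(Nat.le_mul_of_pos_left _ hd₁).trans hω.1.2, (Nat.le_mul_of_pos_left _ hd₂).trans hω.2.2⟩
  rw [this, measure_univ, ← ENNReal.ofReal_one, ENNReal.ofReal_le_ofReal_iff (by norm_num)] at hn
  norm_num at hn

/-- Threshold for the constants in the penalties: large enough for `‖P_X E‖ ≤ c₀ √T / 4`,
`‖E P_Z‖ ≤ c₀ √N / 4` and `‖E‖ ≤ c₀ √(N + T) / 4` to hold with probability tending to one. The
factor `2 C₁ C₂` is the sub-Gaussian parameter of the noise, `512 = 2 * 16²` comes from the Chernoff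
bound at level `c₀ √T / 16`, and the last factor exceeds twice the dimensions divided by `T`, `N` or
`N + T`, as `5 ≤ exp 2`. It is larger than `1`, so that `c₀ ≤ c₀²`. -/
def penaltyThreshold (d₁ d₂ : ℕ) (C₁ C₂ : ℝ) : ℝ :=
  1 + 512 * (2 * C₁ * C₂) * (2 * (d₁ + d₂) + 5)

lemma le_penaltyThreshold_sq {C₁ C₂ : ℝ} (hC₁ : 0 < C₁) (hC₂ : 0 < C₂) {m q : ℝ} (hm : 0 ≤ m)
    (hq : 2 * q + 1 ≤ 2 * (d₁ + d₂) + 5) :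
    (2 * q + 1) * m ≤
      (penaltyThreshold d₁ d₂ C₁ C₂ * √m / 4 / 4) ^ 2 / (2 * (2 * C₁ * C₂)) := by
  set c := penaltyThreshold d₁ d₂ C₁ C₂ with hc
  have hκ : 0 < 2 * C₁ * C₂ := by positivity
  have hc1 : 512 * (2 * C₁ * C₂) * (2 * (d₁ + d₂) + 5) ≤ c ^ 2 := by
    rw [hc, penaltyThreshold]
    have : 0 ≤ 512 * (2 * C₁ * C₂) * (2 * ((d₁ : ℝ) + d₂) + 5) := by positivity
    nlinarith
  rw [le_div_iff₀ (by positivity), div_pow, div_pow, mul_pow, Real.sq_sqrt hm]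
  have h1 : (2 * q + 1) * m ≤ (2 * (d₁ + d₂) + 5) * m := mul_le_mul_of_nonneg_right hq hm
  have h2 := mul_le_mul_of_nonneg_right hc1 hm
  nlinarith

lemma exp_neg_tendsto {a : ℕ → ℕ} (ha : Tendsto a atTop atTop) :
    Tendsto (fun n => ENNReal.ofReal (Real.exp (-(1 * (a n : ℝ))))) atTop (𝓝 0) := by
  have h1 : Tendsto (fun n => Real.exp (-(1 * (a n : ℝ)))) atTop (𝓝 0) := by
    simp only [one_mul]
    exact Real.tendsto_exp_neg_atTop_nhds_zero.comp (tendsto_natCast_atTop_atTop.comp ha)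
  simpa using ENNReal.tendsto_ofReal h1

section NoiseEvents

variable [IsProbabilityMeasure μ] {C₁ C₂ : ℝ}

lemma measurable_rowProj (n : ℕ) (i j : Fin (S.N n)) :
    Measurable fun x : Fin (S.N n) → Fin d₁ → ℝ =>
      projMatrix (Matrix.of fun i => S.rowBasis n (x i)) i j := by
  refine measurable_projMatrix (fun i p => ?_) i j
  exact (S.measurable_φ n p.2).comp
    ((measurable_pi_apply p.1).comp (measurable_pi_apply i))

lemma measurable_colProj (n : ℕ) (i j : Fin (S.T n)) :
    Measurable fun z : Fin (S.T n) → Fin d₂ → ℝ =>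
      projMatrix (Matrix.of fun t => S.colBasis n (z t)) i j := by
  refine measurable_projMatrix (fun i p => ?_) i j
  exact (S.measurable_ψ n p.2).comp
    ((measurable_pi_apply p.1).comp (measurable_pi_apply i))

/-- The doubly projected noise lives in a space of dimension of order `J` by `J`. -/
lemma NoiseAssumption.holdsWithProb_proj (hC₁ : 0 < C₁) (hC₂ : 0 < C₂)
    (h : S.NoiseAssumption μ C₁ C₂) (hJ : ∀ n, 1 ≤ S.J n) {ε : ℝ} (hε : 0 < ε) :
    ∃ A : ℝ, 0 ≤ A ∧ HoldsWithProb μ ε fun n ω =>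
      frobNorm (S.PX n ω * S.E n ω * S.PZ n ω) ≤ A * S.J n := by
  obtain ⟨B, hB0, hB⟩ : ∃ B : ℝ, 0 ≤ B ∧ Real.exp (-B) ≤ ε := by
    refine ⟨max 0 (-Real.log ε), le_max_left _ _, ?_⟩
    rw [← Real.le_log_iff_exp_le hε]
    linarith [le_max_right 0 (-Real.log ε)]
  set q : ℝ := d₁ + d₂ with hq
  set κ : ℝ := 2 * C₁ * C₂ with hκ
  have hκ0 : 0 < κ := by positivity
  -- Chernoff at level `a √J / 4` beats the `5 ^ (q J)` pairs of net points by a factor `exp (-B J)`.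
  set a : ℝ := 4 * √(2 * κ * (2 * q + B)) with ha
  refine ⟨√(d₁ : ℝ) * a, by positivity, Eventually.of_forall fun n => ?_⟩
  have hJ1 : (1 : ℝ) ≤ S.J n := by exact_mod_cast hJ n
  have htail := h.measure_gt_le hC₁ hC₂ n (measurable_rowProj n) (measurable_colProj n)
    (fun y => projMatrix_proj _) (fun y => projMatrix_proj _) (fun y => rank_projMatrix_le _)
    (fun y => rank_projMatrix_le _) (q := q) (m := S.J n) (B := B) (x := a * √(S.J n : ℝ))
    (by positivity) (by simp [hq]; ring_nf; rfl)
    (by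
      rw [le_div_iff₀ (by positivity), ha, div_pow, mul_pow, mul_pow,
        Real.sq_sqrt (Nat.cast_nonneg _), Real.sq_sqrt (by positivity)]
      apply le_of_eq
      ring)
  have hexp : Real.exp (-(B * S.J n)) ≤ ε := (Real.exp_le_exp.2 (by nlinarith)).trans hB
  have hsub : {ω | ¬ frobNorm (S.PX n ω * S.E n ω * S.PZ n ω) ≤ √(d₁ : ℝ) * a * S.J n} ⊆
      {ω | ¬ ‖S.PX n ω * S.E n ω * S.PZ n ω‖ ≤ a * √(S.J n : ℝ)} := by
    intro ω hω hle
    refine hω ?_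
    have e : S.PX n ω * S.E n ω * S.PZ n ω = S.PX n ω * (S.PX n ω * S.E n ω * S.PZ n ω) := by
      rw [← Matrix.mul_assoc, ← Matrix.mul_assoc, (projMatrix_proj (S.Phi n ω)).2 |> fun h' =>
        (show S.PX n ω * S.PX n ω = S.PX n ω from h')]
    have hP : frobNorm (S.PX n ω) ≤ √((d₁ : ℝ) * S.J n) := by
      refine Real.le_sqrt_of_sq_le ((frobNorm_projMatrix_sq_le (S.Phi n ω)).trans_eq ?_)
      simp
    rw [e]
    refine (frobNorm_mul_le_mul_opNorm _ _).trans ((mul_le_mul hP hle (norm_nonneg _)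
      (by positivity)).trans_eq ?_)
    rw [Real.sqrt_mul (Nat.cast_nonneg _)]
    have : √(S.J n : ℝ) * √(S.J n : ℝ) = S.J n := Real.mul_self_sqrt (Nat.cast_nonneg _)
    calc _ = √(d₁ : ℝ) * a * (√(S.J n : ℝ) * √(S.J n : ℝ)) := by ring
      _ = _ := by rw [this]
  exact (measure_mono hsub).trans (htail.trans (ENNReal.ofReal_le_ofReal hexp))

lemma one_proj {N : ℕ} : (1 : Matrix (Fin N) (Fin N) ℝ)ᵀ = 1 ∧
    (1 : Matrix (Fin N) (Fin N) ℝ) * 1 = 1 := ⟨Matrix.transpose_one, Matrix.mul_one _⟩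

/-- The penalties dominate the noise with probability tending to one. -/
lemma NoiseAssumption.holdsWithProb_penalty (hd₁ : 1 ≤ d₁) (hd₂ : 1 ≤ d₂) (hC₁ : 0 < C₁)
    (hC₂ : 0 < C₂) (h : S.NoiseAssumption μ C₁ C₂) (hb : S.BasisAssumption μ)
    (hN : Tendsto S.N atTop atTop) (hT : Tendsto S.T atTop atTop) {ε : ℝ} (hε : 0 < ε) :
    HoldsWithProb μ ε fun n ω =>
      ‖S.PX n ω * S.E n ω‖ ≤ penaltyThreshold d₁ d₂ C₁ C₂ * √(S.T n : ℝ) / 4 ∧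
      ‖S.E n ω * S.PZ n ω‖ ≤ penaltyThreshold d₁ d₂ C₁ C₂ * √(S.N n : ℝ) / 4 ∧
      ‖S.E n ω‖ ≤ penaltyThreshold d₁ d₂ C₁ C₂ * √((S.N n : ℝ) + S.T n) / 4 := by
  set c := penaltyThreshold d₁ d₂ C₁ C₂ with hc
  have hc0 : 0 ≤ c := by rw [hc, penaltyThreshold]; positivity
  have hd₁' : (1 : ℝ) ≤ d₁ := by exact_mod_cast hd₁
  have hd₂' : (1 : ℝ) ≤ d₂ := by exact_mod_cast hd₂
  have w1 : HoldsWithProb μ (ε / 3) fun n ω => ‖S.PX n ω * S.E n ω‖ ≤ c * √(S.T n : ℝ) / 4 := by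
    have hsmall := (exp_neg_tendsto hT).eventually
      (gt_mem_nhds (ENNReal.ofReal_pos.2 (by linarith : 0 < ε / 3)))
    filter_upwards [hb.eventually_J_le hd₁ hd₂, hsmall] with n hJ hn
    have hJT : (S.J n : ℝ) ≤ S.T n := by exact_mod_cast hJ.2
    have := h.measure_gt_le hC₁ hC₂ n (measurable_rowProj n) (Q := fun _ => 1)
      (fun i j => measurable_const) (fun y => projMatrix_proj _) (fun y => one_proj)
      (fun y => rank_projMatrix_le _) (fun y => (Matrix.rank_one (n := Fin (S.T n))).le)
      (q := d₁ + 1) (m := S.T n) (B := 1) (x := c * √(S.T n : ℝ) / 4) (by positivity)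
      (by simp; nlinarith)
      (le_penaltyThreshold_sq hC₁ hC₂ (Nat.cast_nonneg _) (by linarith))
    simp only [Matrix.mul_one] at this
    exact this.trans hn.le
  have w2 : HoldsWithProb μ (ε / 3) fun n ω => ‖S.E n ω * S.PZ n ω‖ ≤ c * √(S.N n : ℝ) / 4 := by
    have hsmall := (exp_neg_tendsto hN).eventually
      (gt_mem_nhds (ENNReal.ofReal_pos.2 (by linarith : 0 < ε / 3)))
    filter_upwards [hb.eventually_J_le hd₁ hd₂, hsmall] with n hJ hn
    have hJN : (S.J n : ℝ) ≤ S.N n := by exact_mod_cast hJ.1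
    have := h.measure_gt_le hC₁ hC₂ n (P := fun _ => 1) (fun i j => measurable_const)
      (measurable_colProj n) (fun y => one_proj) (fun y => projMatrix_proj _)
      (fun y => (Matrix.rank_one (n := Fin (S.N n))).le) (fun y => rank_projMatrix_le _)
      (q := d₂ + 1) (m := S.N n) (B := 1) (x := c * √(S.N n : ℝ) / 4) (by positivity)
      (by simp; nlinarith)
      (le_penaltyThreshold_sq hC₁ hC₂ (Nat.cast_nonneg _) (by linarith))
    simp only [Matrix.one_mul] at this
    exact this.trans hn.le
  have w3 : HoldsWithProb μ (ε / 3) fun n ω =>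
      ‖S.E n ω‖ ≤ c * √((S.N n : ℝ) + S.T n) / 4 := by
    have hsmall := (exp_neg_tendsto (hN.atTop_add_nonneg fun n => Nat.zero_le (S.T n))).eventually
      (gt_mem_nhds (ENNReal.ofReal_pos.2 (by linarith : 0 < ε / 3)))
    filter_upwards [hsmall] with n hn
    have := h.measure_gt_le hC₁ hC₂ n (P := fun _ => 1) (Q := fun _ => 1)
      (fun i j => measurable_const) (fun i j => measurable_const) (fun y => one_proj)
      (fun y => one_proj) (fun y => (Matrix.rank_one (n := Fin (S.N n))).le)
      (fun y => (Matrix.rank_one (n := Fin (S.T n))).le)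
      (q := 1) (m := (S.N n : ℝ) + S.T n) (B := 1) (x := c * √((S.N n : ℝ) + S.T n) / 4)
      (by positivity) (by simp)
      (le_penaltyThreshold_sq hC₁ hC₂ (by positivity) (by linarith))
    simp only [Matrix.one_mul, Matrix.mul_one] at this
    rw [Nat.cast_add] at hn
    exact this.trans hn.le
  have hε3 : 0 ≤ ε / 3 := by linarith
  have := w1.and (w2.and w3 hε3 hε3) hε3 (by linarith)
  have e : ε / 3 + (ε / 3 + ε / 3) = ε := by ring
  rwa [e] at this

end NoiseEvents

end Model

/-! ### The rate of convergence -/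

namespace Model

variable {Ω : Type*} [MeasurableSpace Ω] {d₁ d₂ : ℕ} {S : Model Ω d₁ d₂} {μ : Measure Ω}
  [IsProbabilityMeasure μ] {γ₁G γ₂G γ₁Q γ₂Q : ℝ}

/-- With probability close to one, the four sieve approximation errors are of the order that enters
the rate, and they are dominated by the penalties. -/
lemma holdsWithProb_sieve_errors (hb : S.BasisAssumption μ)
    (hs : S.SieveAssumption μ γ₁G γ₂G γ₁Q γ₂Q) (hm : S.MomentAssumption μ) {ε : ℝ} (hε : 0 < ε) :
    ∃ B : ℝ, 0 ≤ B ∧ HoldsWithProb μ ε fun n ω => ∃ ρG₁ ρG₂ ρQ₁ ρQ₂ : ℝ,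
      (frobNorm ((1 - S.PX n ω) * S.M₁ n ω) ≤ ρG₁ ∧ frobNorm ((1 - S.PX n ω) * S.M₂ n ω) ≤ ρG₂ ∧
        frobNorm (S.M₁ n ω * (1 - S.PZ n ω)) ≤ ρQ₁ ∧ frobNorm (S.M₃ n ω * (1 - S.PZ n ω)) ≤ ρQ₂) ∧
      (ρG₁ ≤ 1 / 12 * √(S.N n : ℝ) ∧ ρG₂ ≤ 1 / 12 * √(S.N n : ℝ) ∧ ρQ₁ ≤ 1 / 12 * √(S.T n : ℝ) ∧
        ρQ₂ ≤ 1 / 12 * √(S.T n : ℝ)) ∧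
      ρG₁ + ρQ₁ + ρG₂ + ρQ₂ ≤ B * (√((S.N n : ℝ) * S.T n) *
        (S.K₁ n / (S.J n : ℝ) ^ γ₁G + S.K₁ n / (S.J n : ℝ) ^ γ₁Q
        + S.K₂ n / (S.J n : ℝ) ^ γ₂G + S.K₃ n / (S.J n : ℝ) ^ γ₂Q)) := by
  obtain ⟨Cf, hCf, hf⟩ := hm.moment_functions
  obtain ⟨Cw, hCw, hw⟩ := hm.moment_factors
  have hε4 : 0 < ε / 4 := by linarith
  have gX : ∀ ε : ℝ, 0 < ε → HoldsWithProb μ ε fun n ω => IsUnit ((S.Phi n ω)ᵀ * S.Phi n ω).det :=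
    fun ε hε => (hb.isUnit_gram hε).mono (Eventually.of_forall fun n ω h => h.1.1)
  have gZ : ∀ ε : ℝ, 0 < ε → HoldsWithProb μ ε fun n ω => IsUnit ((S.Psi n ω)ᵀ * S.Psi n ω).det :=
    fun ε hε => (hb.isUnit_gram hε).mono (Eventually.of_forall fun n ω h => h.2.1)
  obtain ⟨B₁, hB₁, h₁⟩ := holdsWithProb_sieve_le hs.approx_g₁ (x := S.X) ae_mem_rowSupport
    (H := S.Q₁) hCf (fun n t k => (hf n).2.2.1 t k) gX hε4
  obtain ⟨B₂, hB₂, h₂⟩ := holdsWithProb_sieve_le hs.approx_g₂ (x := S.X) ae_mem_rowSupport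
    (H := S.V₁) hCw (fun n t k => (hw n).2.2.1 t k) gX hε4
  obtain ⟨B₃, hB₃, h₃⟩ := holdsWithProb_sieve_le hs.approx_q₁ (x := S.Z) ae_mem_colSupport
    (H := S.G₁) hCf (fun n i k => (hf n).1 i k) gZ hε4
  obtain ⟨B₄, hB₄, h₄⟩ := holdsWithProb_sieve_le hs.approx_q₂ (x := S.Z) ae_mem_colSupport
    (H := S.W₁) hCw (fun n i k => (hw n).1 i k) gZ hε4
  have hJ : ∀ γ : ℝ, ∀ n, 0 ≤ (S.J n : ℝ) ^ γ := fun γ n => Real.rpow_nonneg (Nat.cast_nonneg _) _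
  have h12 : (0 : ℝ) < 1 / 12 := by norm_num
  have e₁ := eventually_mul_sqrt_le (a := S.N) (b := S.T) (fun n => le_rfl) (hJ γ₁G) hs.rate_g₁ hB₁
    h12
  have e₂ := eventually_mul_sqrt_le (a := S.N) (b := S.T) (fun n => le_max_right _ _) (hJ γ₂G)
    hs.rate_g₂ hB₂ h12
  have e₃ := eventually_mul_sqrt_le (a := S.T) (b := S.N) (fun n => le_rfl) (hJ γ₁Q) hs.rate_q₁ hB₃
    h12
  have e₄ := eventually_mul_sqrt_le (a := S.T) (b := S.N) (fun n => le_max_left _ _) (hJ γ₂Q)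
    hs.rate_q₂ hB₄ h12
  refine ⟨B₁ + B₂ + B₃ + B₄, by positivity, ?_⟩
  have hall := (h₁.and h₂ hε4.le hε4.le).and (h₃.and h₄ hε4.le hε4.le) (by linarith) (by linarith)
  have e : ε / 4 + ε / 4 + (ε / 4 + ε / 4) = ε := by ring
  rw [e] at hall
  refine hall.mono ?_
  filter_upwards [e₁, e₂, e₃, e₄] with n e₁ e₂ e₃ e₄ ω ⟨⟨i₁, i₂⟩, i₃, i₄⟩
  have htr : ∀ {k : ℕ} (F : Matrix (Fin (S.T n)) (Fin k) ℝ) (G : Matrix (Fin (S.N n)) (Fin k) ℝ),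
      frobNorm (G * Fᵀ * (1 - S.PZ n ω)) = frobNorm ((1 - S.PZ n ω) * (F * Gᵀ)) := by
    intro k F G
    have hs := (one_sub_proj (projMatrix_proj (S.Psi n ω)).1 (projMatrix_proj (S.Psi n ω)).2).1
    rw [← frobNorm_transpose]
    congr 1
    rw [Matrix.transpose_mul, Matrix.transpose_mul, Matrix.transpose_transpose]
    exact congrArg (· * (F * Gᵀ)) hs
  refine ⟨_, _, _, _, ⟨i₁, i₂, (htr _ _).trans_le i₃, (htr _ _).trans_le i₄⟩, ⟨e₁, e₂, e₃, e₄⟩, ?_⟩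
  rw [mul_comm (S.T n : ℝ)]
  set s := √((S.N n : ℝ) * S.T n)
  have p₁ : 0 ≤ s * (S.K₁ n / (S.J n : ℝ) ^ γ₁G) := by have := hJ γ₁G n; positivity
  have p₂ : 0 ≤ s * (S.K₂ n / (S.J n : ℝ) ^ γ₂G) := by have := hJ γ₂G n; positivity
  have p₃ : 0 ≤ s * (S.K₁ n / (S.J n : ℝ) ^ γ₁Q) := by have := hJ γ₁Q n; positivity
  have p₄ : 0 ≤ s * (S.K₃ n / (S.J n : ℝ) ^ γ₂Q) := by have := hJ γ₂Q n; positivity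
  have q₁ := mul_le_mul_of_nonneg_right (show B₁ ≤ B₁ + B₂ + B₃ + B₄ by linarith) p₁
  have q₂ := mul_le_mul_of_nonneg_right (show B₂ ≤ B₁ + B₂ + B₃ + B₄ by linarith) p₂
  have q₃ := mul_le_mul_of_nonneg_right (show B₃ ≤ B₁ + B₂ + B₃ + B₄ by linarith) p₃
  have q₄ := mul_le_mul_of_nonneg_right (show B₄ ≤ B₁ + B₂ + B₃ + B₄ by linarith) p₄
  linarith

lemma rank_mul_transpose_le {N T K : ℕ} (A : Matrix (Fin N) (Fin K) ℝ)
    (B : Matrix (Fin T) (Fin K) ℝ) : (A * Bᵀ).rank ≤ K := by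
  simpa using (Matrix.rank_mul_le_left A Bᵀ).trans A.rank_le_card_width

/-- The estimation error is of the order of the rate, in Frobenius norm. -/
theorem holdsWithProb_frobNorm_sub_le (hd₁ : 1 ≤ d₁) (hd₂ : 1 ≤ d₂) {C₁ C₂ : ℝ} (hC₁ : 0 < C₁)
    (hC₂ : 0 < C₂) {c₂ c₃ c₄ : ℝ} (hc₂ : penaltyThreshold d₁ d₂ C₁ C₂ ≤ c₂)
    (hc₃ : penaltyThreshold d₁ d₂ C₁ C₂ ≤ c₃) (hc₄ : penaltyThreshold d₁ d₂ C₁ C₂ ≤ c₄)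
    (hN : Tendsto S.N atTop atTop) (hT : Tendsto S.T atTop atTop) (hJ : ∀ n, 1 ≤ S.J n)
    (hn : S.NoiseAssumption μ C₁ C₂) (hb : S.BasisAssumption μ)
    (hs : S.SieveAssumption μ γ₁G γ₂G γ₁Q γ₂Q) (hm : S.MomentAssumption μ) {ε : ℝ} (hε : 0 < ε) :
    ∃ C : ℝ, 0 < C ∧ HoldsWithProb μ ε fun n ω => ∀ Mhat, S.IsEstimator c₂ c₃ c₄ n ω Mhat →
      frobNorm (Mhat - S.M n ω) ≤ C * S.rate γ₁G γ₂G γ₁Q γ₂Q n ω := by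
  set c₀ := penaltyThreshold d₁ d₂ C₁ C₂ with hc₀
  have hc₀1 : 1 ≤ c₀ := by
    rw [hc₀, penaltyThreshold]
    have : 0 ≤ 512 * (2 * C₁ * C₂) * (2 * ((d₁ : ℝ) + d₂) + 5) := by positivity
    linarith
  have hc₀0 : 0 < c₀ := by linarith
  have hε3 : 0 < ε / 3 := by linarith
  obtain ⟨A, hA, h₁⟩ := hn.holdsWithProb_proj hC₁ hC₂ hJ hε3
  have h₂ := hn.holdsWithProb_penalty hd₁ hd₂ hC₁ hC₂ hb hN hT hε3
  obtain ⟨B, hB, h₃⟩ := holdsWithProb_sieve_errors hb hs hm hε3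
  have hall := h₁.and (h₂.and h₃ hε3.le hε3.le) hε3.le (by linarith)
  have e : ε / 3 + (ε / 3 + ε / 3) = ε := by ring
  rw [e] at hall
  refine ⟨A + 3 * c₂ + 3 * c₃ + 3 * c₄ + 2 * B, by linarith, hall.mono
    (Eventually.of_forall fun n ω hω => ?_)⟩
  obtain ⟨hE₁, ⟨hE₂, hE₃, hE₄⟩, ρG₁, ρG₂, ρQ₁, ρQ₂, ⟨r₁, r₂, r₃, r₄⟩, ⟨s₁, s₂, s₃, s₄⟩, hρ⟩ := hω
  rintro Mhat ⟨A₂, A₃, A₄, m₂, m₃, m₄, rfl⟩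
  have hTN : √(S.T n : ℝ) ≤ √((S.N n : ℝ) + S.T n) := Real.sqrt_le_sqrt (by simp)
  have hNT : √(S.N n : ℝ) ≤ √((S.N n : ℝ) + S.T n) := Real.sqrt_le_sqrt (by simp)
  have nT := Real.sqrt_nonneg (S.T n : ℝ)
  have nN := Real.sqrt_nonneg (S.N n : ℝ)
  have nNT := Real.sqrt_nonneg ((S.N n : ℝ) + S.T n)
  have cT : √(S.T n : ℝ) ≤ c₀ * √(S.T n : ℝ) := le_mul_of_one_le_left nT hc₀1
  have cN : √(S.N n : ℝ) ≤ c₀ * √(S.N n : ℝ) := le_mul_of_one_le_left nN hc₀1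
  have cNT : √((S.N n : ℝ) + S.T n) ≤ c₀ * √((S.N n : ℝ) + S.T n) :=
    le_mul_of_one_le_left nNT hc₀1
  have hmul : ∀ c s : ℝ, c / c₀ * (c₀ * s) = c * s := fun c s => by field_simp
  -- The penalty level `c √T` is split as `(c / c₀) * (c₀ √T)`, the second factor dominating
  -- the noise.
  have key := frobNorm_estimator_sub_le (P := S.PX n ω) (Q := S.PZ n ω) (M₁ := S.M₁ n ω)
    (M₂ := S.M₂ n ω) (M₃ := S.M₃ n ω) (M₄ := S.M₄ n ω) (E := S.E n ω) (A₂ := A₂) (A₃ := A₃)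
    (A₄ := A₄) (projMatrix_proj _) (projMatrix_proj _) (c₂ := c₂ / c₀) (c₃ := c₃ / c₀)
    (c₄ := c₄ / c₀) (s₂ := c₀ * √(S.T n : ℝ)) (s₃ := c₀ * √(S.N n : ℝ))
    (s₄ := c₀ * √((S.N n : ℝ) + S.T n)) (K₂ := S.K₂ n) (K₃ := S.K₃ n) (K₄ := S.K₄ n)
    ((one_le_div hc₀0).2 hc₂) ((one_le_div hc₀0).2 hc₃) ((one_le_div hc₀0).2 hc₄)
    (by positivity) (by positivity) (by positivity) (rank_mul_transpose_le _ _)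
    (rank_mul_transpose_le _ _) (rank_mul_transpose_le _ _) r₁ r₂ r₃ r₄ (by linarith) (by linarith)
    (by linarith) hE₁ hE₂ hE₃ hE₄ (by rw [hmul]; exact m₂) (by rw [hmul]; exact m₃)
    (by rw [hmul]; exact m₄)
  have hmin : ∀ c k s x : ℝ, 0 ≤ c → 0 ≤ k → 0 ≤ x →
      3 * (c / c₀) * (k * min (c₀ * s) x) ≤ 3 * c * (k * min s x) := by
    intro c k s x hc hk hx
    have h : min (c₀ * s) x ≤ c₀ * min s x := by
      rw [mul_min_of_nonneg _ _ hc₀0.le]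
      exact min_le_min_left _ (le_mul_of_one_le_left hx hc₀1)
    calc 3 * (c / c₀) * (k * min (c₀ * s) x) ≤ 3 * (c / c₀) * (k * (c₀ * min s x)) := by gcongr
      _ = _ := by field_simp
  refine key.trans ?_
  have f₂ := add_nonneg (frobNorm_nonneg (S.M₂ n ω)) (frobNorm_nonneg (S.PX n ω * S.M₄ n ω))
  have f₃ := add_nonneg (frobNorm_nonneg (S.M₃ n ω)) (frobNorm_nonneg (S.M₄ n ω * S.PZ n ω))
  have f₄ := frobNorm_nonneg (S.M₄ n ω)
  have b₂ := hmin c₂ (√((S.K₂ n + S.K₄ n : ℕ) : ℝ)) (√(S.T n : ℝ)) _ (by linarith)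
    (Real.sqrt_nonneg _) f₂
  have b₃ := hmin c₃ (√((S.K₃ n + S.K₄ n : ℕ) : ℝ)) (√(S.N n : ℝ)) _ (by linarith)
    (Real.sqrt_nonneg _) f₃
  have b₄ := hmin c₄ (√(S.K₄ n : ℝ)) (√((S.N n : ℝ) + S.T n)) _ (by linarith)
    (Real.sqrt_nonneg _) f₄
  have hJ' : ∀ γ : ℝ, 0 ≤ (S.J n : ℝ) ^ γ := fun γ => Real.rpow_nonneg (Nat.cast_nonneg _) _
  have j₁ := hJ' γ₁G
  have j₂ := hJ' γ₂G
  have j₃ := hJ' γ₁Q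
  have j₄ := hJ' γ₂Q
  rw [Nat.cast_add] at b₂ b₃ ⊢
  rw [Nat.cast_add]
  unfold rate
  set t₁ := (S.J n : ℝ)
  set t₂ := √((S.K₂ n : ℝ) + S.K₄ n) *
    min √(S.T n : ℝ) (frobNorm (S.M₂ n ω) + frobNorm (S.PX n ω * S.M₄ n ω))
  set t₃ := √((S.K₃ n : ℝ) + S.K₄ n) *
    min √(S.N n : ℝ) (frobNorm (S.M₃ n ω) + frobNorm (S.M₄ n ω * S.PZ n ω))
  set t₄ := √(S.K₄ n : ℝ) * min √((S.N n : ℝ) + S.T n) (frobNorm (S.M₄ n ω))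
  set t₅ := √((S.N n : ℝ) * S.T n) *
      (S.K₁ n / (S.J n : ℝ) ^ γ₁G + S.K₁ n / (S.J n : ℝ) ^ γ₁Q
        + S.K₂ n / (S.J n : ℝ) ^ γ₂G + S.K₃ n / (S.J n : ℝ) ^ γ₂Q)
  have p₁ : 0 ≤ t₁ := Nat.cast_nonneg _
  have p₂ : 0 ≤ t₂ := by positivity
  have p₃ : 0 ≤ t₃ := by positivity
  have p₄ : 0 ≤ t₄ := by positivity
  have p₅ : 0 ≤ t₅ := by positivity
  set C := A + 3 * c₂ + 3 * c₃ + 3 * c₄ + 2 * B with hC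
  have q₁ : A * t₁ ≤ C * t₁ := mul_le_mul_of_nonneg_right (by linarith) p₁
  have q₂ : 3 * c₂ * t₂ ≤ C * t₂ := mul_le_mul_of_nonneg_right (by linarith) p₂
  have q₃ : 3 * c₃ * t₃ ≤ C * t₃ := mul_le_mul_of_nonneg_right (by linarith) p₃
  have q₄ : 3 * c₄ * t₄ ≤ C * t₄ := mul_le_mul_of_nonneg_right (by linarith) p₄
  have q₅ : 2 * B * t₅ ≤ C * t₅ := mul_le_mul_of_nonneg_right (by linarith) p₅
  linarith

end Model

end SideInfo

end

theorem corollary1 (d₁ d₂ : ℕ) (hd₁ : 1 ≤ d₁) (hd₂ : 1 ≤ d₂) (C₁ C₂ : ℝ) (hC₁ : 0 < C₁)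
    (hC₂ : 0 < C₂) :
    ∃ c₀ : ℝ, 0 < c₀ ∧ ∀ c₂ c₃ c₄ : ℝ, c₀ ≤ c₂ → c₀ ≤ c₃ → c₀ ≤ c₄ →
    ∀ (Ω : Type*) [MeasurableSpace Ω] (μ : Measure Ω) [IsProbabilityMeasure μ]
      (S : SideInfo.Model Ω d₁ d₂) (γ₁G γ₂G γ₁Q γ₂Q : ℝ),
      Tendsto S.N atTop atTop → Tendsto S.T atTop atTop → (∀ n, 1 ≤ S.J n) →
      S.NoiseAssumption μ C₁ C₂ → S.BasisAssumption μ →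
      S.SieveAssumption μ γ₁G γ₂G γ₁Q γ₂Q → S.MomentAssumption μ →
      TendstoInMeasure μ (S.relRate γ₁G γ₂G γ₁Q γ₂Q) atTop (fun _ => 0) →
    ∀ (Mhat : ∀ n, Ω → Matrix (Fin (S.N n)) (Fin (S.T n)) ℝ)
      (U Uhat : ∀ n ω, Matrix (Fin (S.N n)) (Fin (S.M n ω).rank) ℝ)
      (V Vhat : ∀ n ω, Matrix (Fin (S.T n)) (Fin (S.M n ω).rank) ℝ),
      (∀ n ω, S.IsEstimator c₂ c₃ c₄ n ω (Mhat n ω)) →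
      (∀ n ω, SideInfo.IsTopSingularVectors (S.M n ω) (U n ω) (V n ω)) →
      (∀ n ω, SideInfo.IsTopSingularVectors (Mhat n ω) (Uhat n ω) (Vhat n ω)) →
      SideInfo.IsBigOp μ
        (fun n ω => max (SideInfo.rotationDist (Uhat n ω) (U n ω))
          (SideInfo.rotationDist (Vhat n ω) (V n ω)))
        (S.relRate γ₁G γ₂G γ₁Q γ₂Q) := by
  refine ⟨SideInfo.Model.penaltyThreshold d₁ d₂ C₁ C₂, by
    unfold SideInfo.Model.penaltyThreshold; positivity, ?_⟩
  intro c₂ c₃ c₄ hc₂ hc₃ hc₄ Ω _ μ _ S γ₁G γ₂G γ₁Q γ₂Q hN hT hJ hn hb hs hm hrate Mhat U Uhat V Vhat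
    hest hU hUhat ε hε
  obtain ⟨C, hC, herr⟩ := SideInfo.Model.holdsWithProb_frobNorm_sub_le hd₁ hd₂ hC₁ hC₂ hc₂ hc₃ hc₄
    hN hT hJ hn hb hs hm (half_pos hε)
  -- With probability tending to one the rate is small enough for the perturbation bound to apply.
  have hgap : SideInfo.HoldsWithProb μ (ε / 2)
      fun n ω => S.relRate γ₁G γ₂G γ₁Q γ₂Q n ω < 1 / (4 * C) := by
    refine SideInfo.HoldsWithProb.mono (SideInfo.holdsWithProb_of_tendsto (p := fun n ω =>
      ¬ 1 / (4 * C) ≤ ‖S.relRate γ₁G γ₂G γ₁Q γ₂Q n ω - 0‖) ?_ (half_pos hε))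
      (Eventually.of_forall fun n ω hω => ?_)
    · simp only [not_not]
      exact (tendstoInMeasure_iff_norm.1 hrate) _ (by positivity)
    · rw [not_le, sub_zero] at hω
      exact (le_abs_self _).trans_lt hω
  have hboth := herr.and hgap (half_pos hε).le (half_pos hε).le
  rw [add_halves] at hboth
  refine ⟨3 * C, by positivity, ?_⟩
  filter_upwards [hboth] with n hn'
  refine (measure_mono ?_).trans hn'
  intro ω hω hgood
  obtain ⟨h1, h2⟩ := hgood
  have h1 := h1 _ (hest n ω)
  have hlam := SideInfo.minNonzeroSingularValue_nonneg (S.M n ω)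
  have hmax := SideInfo.rotationDist_le rfl (hU n ω) (hUhat n ω) fun hK => by
    have hpos := SideInfo.minNonzeroSingularValue_pos hK
    rw [SideInfo.Model.relRate, div_lt_div_iff₀ hpos (by positivity)] at h2
    linarith
  have h3 : 3 * SideInfo.frobNorm (Mhat n ω - S.M n ω) /
      SideInfo.minNonzeroSingularValue (S.M n ω) ≤ 3 * C * S.relRate γ₁G γ₂G γ₁Q γ₂Q n ω := by
    rw [SideInfo.Model.relRate, ← mul_div_assoc]
    refine div_le_div_of_nonneg_right ?_ hlam
    linarith
  have h4 : 0 ≤ SideInfo.rotationDist (Uhat n ω) (U n ω) :=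
    Real.iInf_nonneg fun R => SideInfo.frobNorm_nonneg _
  rw [Set.mem_ofPred_eq, abs_of_nonneg (h4.trans (le_max_left _ _))] at hω
  linarith
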